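/- **Conventions.** Let $\Gamma=(W,E)$ be a finite non-empty simple graph, $A_\Gamma=\langle W\mid [a,b]=1 \text{ for } \{a,b\}\in E\rangle$ its right-angled Artin group, and $\mathbb S_\Gamma$ its Salvetti complex, i.e. the subcomplex of the torus $(S^1)^W$ whose cubes correspond to the cliques of $\Gamma$. Let a group $G$ act by combinatorial isometries on a $\mathrm{CAT}(0)$ cube complex $Z$. Hyperplanes are parallelism classes of edges, and two hyperplanes are transverse if they have dual edges spanning a square; the carrier of a hyperplane is the union of the closed cubes containing an edge dual to it; $\mathrm{Sep}(H\mid K)$ is the set of hyperplanes having the carrier of $H$ in one halfspace and the carrier of $K$ in the other. *Cospecial actions.* A free action of $G$ on $Z$ is *cospecial* if for all $g\in G$ and all hyperplanes $H,K$ of $Z$: (i) if $gH=H$ then $g$ does not exchange the halfspaces of $H$; (ii) $H$ and $gH$ are not transverse; (iii) if the carriers of $H$ and $gH$ intersect, then $H^+\cap gH^+\neq\emptyset$ and $H^-\cap gH^-\neq\emptyset$, where $H^\pm$ are the halfspaces of $H$; (iv) if $H$ and $K$ are transverse and the carriers of $gH$ and $K$ intersect, then $gH$ and $K$ are transverse.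 A *special cube complex* is the quotient $Z/G$ of a cospecial action. *Strong collapses.* A $G$-invariant family $\mathcal H$ of hyperplanes is *strongly collapsible* if $\mathrm{Sep}(H\mid gH)\not\subseteq\mathcal H$ for all $H\in\mathcal H$ and all $g\in G$ with $gH\neq H$. The *collapse* of $\mathcal H$ is the $G$-equivariant restriction quotient of $Z$ onto the $\mathrm{CAT}(0)$ cube complex dual (by Sageev's construction) to the wallspace formed by the vertices of $Z$ and the hyperplanes not in $\mathcal H$; it is a *strong collapse* if $\mathcal H$ is strongly collapsible. *Redundant pairs.* A pair of distinct hyperplanes $\{H_1,H_2\}$ of a locally $\mathrm{CAT}(0)$ cube complex $X$ is *redundant* if there are a locally $\mathrm{CAT}(0)$ cube complex $Y$, a two-sided non-self-intersecting hyperplane $H$ of $Y$, and an isomorphism from $X$ to the subdivision of $Y$ along $H$ (cut at the midpoint of the direction dual to $H$ each cube containing an edge dual to $H$) which maps $H_1,H_2$ to the two hyperplanes into which $H$ is divided. *Cospatial actions.* A free cocompact action of $A_\Gamma$ on a $\mathrm{CAT}(0)$ cube complex $Z$ is *Salvetti-like* if $Z/A_\Gamma$ is combinatorially isomorphic to $\mathbb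 S_\Gamma$. It is *cospatial* if $Z/A_\Gamma$ has no redundant pair of hyperplanes and, for every hyperplane $H$ of $Z$, there is a strong collapse of $Z$ that does not collapse $H$ and whose range is Salvetti-like. A *spatial cube complex* is the quotient of a cospatial action of $A_\Gamma$, for some finite non-empty simple graph $\Gamma$. **Lemma.** Every cospatial action of a right-angled Artin group $A_\Gamma$ is cospecial. In particular, every spatial cube complex is special. The converse fails: let $\mathbb Z^2=A_\Gamma$, with $\Gamma$ a single edge, act on $\mathbb R^2$ with its standard cubical subdivision, the two standard generators acting as the translations by $(1,1)$ and $(-1,1)$. This action is free, cocompact and cospecial, but not cospatial; its quotient is a special cube complex which is not spatial. -/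

import Mathlib

open scoped Pointwise

universe u v

namespace CubeCx

/-! ## Faces of cubes and cube complexes -/

/-- A parametrized `m`-face of the cube `[0,1]^n`: the affine isometric map `[0,1]^m → [0,1]^n`
sending the origin to the vertex `base` and the `i`-th axis to the axis `dir i`. Every isometry of
`[0,1]^m` onto an `m`-dimensional face of `[0,1]^n` is of this form, in a unique way. For `m = n`
these are the symmetries of the cube. -/
@[ext]
structure FaceMap (m n : ℕ) where
  base : Fin n → Bool
  dir : Fin m ↪ Fin n

namespace FaceMap

/-- The action of a face map on vertices of cubes. -/
noncomputable def app {m n : ℕ} (f : FaceMap m n) (x : Fin m → Bool) : Fin n → Bool :=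
  fun j => xor (f.base j) (Function.extend f.dir x (fun _ => false) j)

/-- The action of a face map on points (with rational coordinates) of cubes. -/
noncomputable def affine {m n : ℕ} (f : FaceMap m n) (p : Fin m → ℚ) : Fin n → ℚ :=
  fun j =>
    if f.base j then 1 - Function.extend f.dir p (fun _ => 0) j
    else Function.extend f.dir p (fun _ => 0) j

/-- The identity of the cube. -/
def idm (n : ℕ) : FaceMap n n := ⟨fun _ => false, Function.Embedding.refl _⟩

/-- Composition of face maps (`g` after `f`). -/
noncomputable def comp {k m n : ℕ} (g : FaceMap m n) (f : FaceMap k m) : FaceMap k n :=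
  ⟨g.app f.base, f.dir.trans g.dir⟩

/-- The vertex `x` of a cube. -/
def vertex {n : ℕ} (x : Fin n → Bool) : FaceMap 0 n := ⟨x, ⟨Fin.elim0, fun a => a.elim0⟩⟩

/-- The edge of a cube issued from the vertex `x` in the direction `i`. -/
def edge {n : ℕ} (x : Fin n → Bool) (i : Fin n) : FaceMap 1 n :=
  ⟨x, ⟨fun _ => i, fun _ _ _ => Subsingleton.elim _ _⟩⟩

/-- The reversal `t ↦ 1 - t` of the unit interval. -/
def rev : FaceMap 1 1 := edge (fun _ => true) 0

theorem app_dir {m n : ℕ} (f : FaceMap m n) (x : Fin m → Bool) (i : Fin m) :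
    f.app x (f.dir i) = xor (f.base (f.dir i)) (x i) := by
  simp [app, f.dir.injective.extend_apply]

theorem app_of_not {m n : ℕ} (f : FaceMap m n) (x : Fin m → Bool) (j : Fin n)
    (h : ¬ ∃ i, f.dir i = j) : f.app x j = f.base j := by
  simp [app, Function.extend_apply' _ _ _ h]

theorem app_idm {n : ℕ} (x : Fin n → Bool) : (idm n).app x = x := by
  funext j
  have := app_dir (idm n) x j
  simpa [idm] using this

theorem app_comp {k m n : ℕ} (g : FaceMap m n) (f : FaceMap k m) (x : Fin k → Bool) :
    (g.comp f).app x = g.app (f.app x) := by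
  funext j
  by_cases hj : ∃ i, g.dir i = j
  · obtain ⟨i, rfl⟩ := hj
    rw [app_dir g]
    by_cases hi : ∃ l, f.dir l = i
    · obtain ⟨l, rfl⟩ := hi
      have := app_dir (g.comp f) x l
      simp only [comp, Function.Embedding.trans_apply] at this ⊢
      rw [this, app_dir g, app_dir f, Bool.xor_assoc]
    · rw [app_of_not f x i hi, app_of_not]
      · simp only [comp]
        rw [app_dir g]
      · rintro ⟨l, hl⟩
        exact hi ⟨l, g.dir.injective hl⟩
  · rw [app_of_not g _ j hj, app_of_not]
    · simp only [comp]
      rw [app_of_not g _ j hj]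
    · rintro ⟨l, hl⟩
      exact hj ⟨f.dir l, hl⟩

theorem hammingDist_app {m n : ℕ} (f : FaceMap m n) (x y : Fin m → Bool) :
    hammingDist (f.app x) (f.app y) = hammingDist x y := by
  unfold hammingDist
  rw [← Finset.card_map f.dir]
  congr 1
  ext j
  simp only [Finset.mem_filter, Finset.mem_univ, true_and, Finset.mem_map]
  constructor
  · intro h
    by_cases hj : ∃ i, f.dir i = j
    · obtain ⟨i, rfl⟩ := hj
      refine ⟨i, ?_, rfl⟩
      rintro hxy
      exact h (by rw [app_dir, app_dir, hxy])
    · exact absurd (by rw [app_of_not f x j hj, app_of_not f y j hj]) h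
  · rintro ⟨i, h, rfl⟩
    rw [app_dir, app_dir]
    intro h'
    exact h (by simpa using h')

theorem edge_zero_eq : edge (fun _ : Fin 1 => false) 0 = idm 1 := by
  ext i
  · rfl
  · simp

end FaceMap

/-- A (possibly orbifold) cube complex, given by its *parametrized cubes*: `Cell n` is the set of
characteristic maps `[0,1]^n → X` of `n`-dimensional cubes (so that each `n`-cube of `X` occurs once
for each symmetry of `[0,1]^n`), and `face f c` is the restriction of the characteristic map `c`
to a parametrized face `f`. Cubes may be glued to themselves and to each other along faces in an
arbitrary way. -/
structure CubicalSet where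
  Cell : ℕ → Type u
  face : ∀ {m n : ℕ}, FaceMap m n → Cell n → Cell m
  face_idm : ∀ {n : ℕ} (c : Cell n), face (FaceMap.idm n) c = c
  face_comp : ∀ {k m n : ℕ} (g : FaceMap m n) (f : FaceMap k m) (c : Cell n),
    face (g.comp f) c = face f (face g c)

namespace CubicalSet

/-- Combinatorial isomorphisms. -/
structure Iso (X : CubicalSet.{u}) (Y : CubicalSet.{v}) where
  equiv : ∀ n, X.Cell n ≃ Y.Cell n
  map_face : ∀ {m n : ℕ} (f : FaceMap m n) (c : X.Cell n),
    equiv m (X.face f c) = Y.face f (equiv n c)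

/-- `X` is a genuine cube complex: the interior of each cube embeds, i.e. no cube is identified
with itself through a nontrivial symmetry. -/
def IsCubeComplex (X : CubicalSet.{u}) : Prop :=
  ∀ (n : ℕ) (c : X.Cell n) (f : FaceMap n n), X.face f c = c → f = FaceMap.idm n

/-- A cube complex has finitely many cells if and only if it is compact. -/
def IsCompact (X : CubicalSet.{u}) : Prop := Finite (Σ n, X.Cell n)

/-- The initial vertex of a parametrized cube. -/
def origin (X : CubicalSet.{u}) {n : ℕ} (c : X.Cell n) : X.Cell 0 :=
  X.face (FaceMap.vertex fun _ => false) c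

/-- The edge of a parametrized cube issued from its initial vertex in the direction `i`. -/
def axis (X : CubicalSet.{u}) {n : ℕ} (c : X.Cell n) (i : Fin n) : X.Cell 1 :=
  X.face (FaceMap.edge (fun _ => false) i) c

/-- The same edge with the opposite parametrization. -/
def reverse (X : CubicalSet.{u}) (e : X.Cell 1) : X.Cell 1 := X.face FaceMap.rev e

/-- The oriented edges `e`, `f` are the corners of a square at a vertex. -/
def SpanSquare (X : CubicalSet.{u}) (e f : X.Cell 1) : Prop :=
  ∃ s : X.Cell 2, X.axis s 0 = e ∧ X.axis s 1 = f

/-- Gromov's link condition: the link of each vertex is a flag simplicial complex. The vertices of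
the link of `v` are the oriented edges issued from `v`, and its simplices are the corners at `v` of
cubes of `X`. -/
structure LinkCondition (X : CubicalSet.{u}) : Prop where
  simplicial : ∀ s : X.Cell 2, X.axis s 0 ≠ X.axis s 1
  flag : ∀ (v : X.Cell 0) (n : ℕ) (e : Fin n → X.Cell 1), (∀ i, X.origin (e i) = v) →
    (∀ i j, i ≠ j → X.SpanSquare (e i) (e j)) →
    ∃! c : X.Cell n, X.origin c = v ∧ ∀ i, X.axis c i = e i

/-- Locally CAT(0) cube complexes. -/
def IsLocallyCAT0 (X : CubicalSet.{u}) : Prop := X.IsCubeComplex ∧ X.LinkCondition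

/-- `e` and `f` are opposite edges of a square, with the same orientation. -/
def Opposite (X : CubicalSet.{u}) (e f : X.Cell 1) : Prop :=
  ∃ s : X.Cell 2, X.face (FaceMap.edge ![false, false] 0) s = e ∧
    X.face (FaceMap.edge ![false, true] 0) s = f

/-- Parallelism of oriented edges. -/
def OrientedParallel (X : CubicalSet.{u}) : X.Cell 1 → X.Cell 1 → Prop :=
  Relation.EqvGen X.Opposite

/-- The hyperplane dual to the edge `e`: all edges parallel to `e`, with both parametrizations. -/
def hyperplane (X : CubicalSet.{u}) (e : X.Cell 1) : Set (X.Cell 1) :=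
  {f | X.OrientedParallel e f ∨ X.OrientedParallel (X.reverse e) f}

/-- The hyperplane dual to `e` is two-sided. -/
def TwoSided (X : CubicalSet.{u}) (e : X.Cell 1) : Prop :=
  ¬ X.OrientedParallel e (X.reverse e)

/-- The hyperplane dual to `e` does not self-intersect: no two adjacent edges of a square are dual
to it. -/
def NonSelfIntersecting (X : CubicalSet.{u}) (e : X.Cell 1) : Prop :=
  ∀ s : X.Cell 2, ¬ (X.axis s 0 ∈ X.hyperplane e ∧ X.axis s 1 ∈ X.hyperplane e)

/-! ### Subdivision along a hyperplane -/

open Classical in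
/-- Subdivide the cube `[0,1]^m` along the directions in `D`, by cutting `[0,1]` at `1/2` in each of
these directions. `φ` parametrizes an `n`-cube of this subdivision: it is an isometric embedding
of the vertices of the `n`-cube into the vertices of the subdivision, where distances are
measured in the `1`-skeleton of the subdivision (its edges in directions of `D` have length `1/2` in
`[0,1]^m`). -/
def IsSubdividedCube {m n : ℕ} (D : Set (Fin m)) (φ : (Fin n → Bool) → (Fin m → ℚ)) : Prop :=
  (∀ x i, φ x i = 0 ∨ φ x i = 1 ∨ (i ∈ D ∧ φ x i = 1 / 2)) ∧
  ∀ x y, ∑ i, (if i ∈ D then 2 else 1) * |φ x i - φ y i| = (hammingDist x y : ℚ)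

/-- A parametrized `n`-cube of the subdivision, along the hyperplane dual to `e`, of some cube
of `X`. -/
structure SubCell (X : CubicalSet.{u}) (e : X.Cell 1) (n : ℕ) where
  dim : ℕ
  cube : X.Cell dim
  map : (Fin n → Bool) → (Fin dim → ℚ)
  isCube : IsSubdividedCube {i | X.axis cube i ∈ X.hyperplane e} map

/-- Cubes of the subdivision of a face of a cube `c` are cubes of the subdivision of `c`. -/
def SubRel (X : CubicalSet.{u}) (e : X.Cell 1) (n : ℕ) (s t : X.SubCell e n) : Prop :=
  ∃ f : FaceMap s.dim t.dim, s.cube = X.face f t.cube ∧ ∀ x, t.map x = f.affine (s.map x)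

/-- Restriction of a cube of the subdivision to a face. -/
noncomputable def SubCell.face {X : CubicalSet.{u}} {e : X.Cell 1} {k n : ℕ} (f : FaceMap k n)
    (s : X.SubCell e n) : X.SubCell e k where
  dim := s.dim
  cube := s.cube
  map := fun x => s.map (f.app x)
  isCube := ⟨fun x i => s.isCube.1 (f.app x) i, fun x y => by
    rw [s.isCube.2, FaceMap.hammingDist_app]⟩

/-- The subdivision of `X` along the hyperplane dual to `e`: glue the subdivisions of the cubes
of `X`. -/
noncomputable def subdivision (X : CubicalSet.{u}) (e : X.Cell 1) : CubicalSet.{u} where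
  Cell n := Quot (X.SubRel e n)
  face f := Quot.map (SubCell.face f) (by
    rintro s t ⟨g, hc, hm⟩
    exact ⟨g, hc, fun x => hm _⟩)
  face_idm := by
    rintro n ⟨s⟩
    simp only [Quot.map, SubCell.face, FaceMap.app_idm]
  face_comp := by
    rintro k m n g f ⟨s⟩
    simp only [Quot.map, SubCell.face, FaceMap.app_comp]

theorem mem_hyperplane_self (X : CubicalSet.{u}) (e : X.Cell 1) (i : Fin 1) :
    X.axis e i ∈ X.hyperplane e := by
  have hi : i = 0 := Subsingleton.elim _ _
  subst hi
  unfold axis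
  rw [FaceMap.edge_zero_eq, X.face_idm]
  exact Or.inl (Relation.EqvGen.refl _)

/-- The first half `[0,1/2]` of the edge `e` in the subdivision along its dual hyperplane. -/
def lowerHalf (X : CubicalSet.{u}) (e : X.Cell 1) : (X.subdivision e).Cell 1 :=
  Quot.mk _
    { dim := 1
      cube := e
      map := fun x _ => if x 0 then 1 / 2 else 0
      isCube := by
        refine ⟨fun x i => ?_, fun x y => ?_⟩
        · by_cases h : x 0 <;> simp [h, mem_hyperplane_self]
        · simp only [Set.mem_ofPred_eq, mem_hyperplane_self, hammingDist]
          rcases hx : x 0 <;> rcases hy : y 0 <;> simp [hx, hy, Finset.filter_singleton] }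

/-- The second half `[1/2,1]` of the edge `e` in the subdivision along its dual hyperplane. -/
def upperHalf (X : CubicalSet.{u}) (e : X.Cell 1) : (X.subdivision e).Cell 1 :=
  Quot.mk _
    { dim := 1
      cube := e
      map := fun x _ => if x 0 then 1 else 1 / 2
      isCube := by
        refine ⟨fun x i => ?_, fun x y => ?_⟩
        · by_cases h : x 0 <;> simp [h, mem_hyperplane_self]
        · simp only [Set.mem_ofPred_eq, mem_hyperplane_self, hammingDist]
          rcases hx : x 0 <;> rcases hy : y 0 <;>
            norm_num [hx, hy, Finset.filter_singleton, abs_of_pos, abs_of_neg] }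

/-- The pair of hyperplanes `{H₁, H₂}` of `X` is redundant: they are distinct, and `X` is isomorphic
to the subdivision of a locally CAT(0) cube complex `Y` along a two-sided, non-self-intersecting
hyperplane (the one dual to the edge `e`), in such a way that `H₁`, `H₂` correspond to the two
hyperplanes of the subdivision dual to the halves of `e`. -/
def IsRedundantPair (X : CubicalSet.{u}) (H₁ H₂ : Set (X.Cell 1)) : Prop :=
  H₁ ≠ H₂ ∧ ∃ (Y : CubicalSet.{u}) (e : Y.Cell 1),
    Y.IsLocallyCAT0 ∧ Y.TwoSided e ∧ Y.NonSelfIntersecting e ∧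
    ∃ Φ : Iso X (Y.subdivision e),
      Φ.equiv 1 '' H₁ = (Y.subdivision e).hyperplane (Y.lowerHalf e) ∧
      Φ.equiv 1 '' H₂ = (Y.subdivision e).hyperplane (Y.upperHalf e)

end CubicalSet

/-! ## CAT(0) cube complexes

A CAT(0) cube complex is determined by its `1`-skeleton, which is a median graph; conversely, any
median graph is the `1`-skeleton of a CAT(0) cube complex, with a cube glued on each subgraph
isomorphic to the `1`-skeleton of a cube. We identify CAT(0) cube complexes with median graphs. -/

section CAT0

variable {V : Type u}

/-- Median graphs. -/
def IsMedian (Z : SimpleGraph V) : Prop :=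
  Z.Connected ∧ ∀ x y z : V, ∃! m : V,
    Z.dist x y = Z.dist x m + Z.dist m y ∧
    Z.dist y z = Z.dist y m + Z.dist m z ∧
    Z.dist x z = Z.dist x m + Z.dist m z

/-- The parametrized `n`-cubes of `Z`. -/
def IsCube (Z : SimpleGraph V) {n : ℕ} (c : (Fin n → Bool) → V) : Prop :=
  ∀ x y, Z.dist (c x) (c y) = hammingDist x y

/-- The oriented edges `p` and `q` are opposite edges of a square, with the same orientation. -/
def Opposite (Z : SimpleGraph V) (p q : V × V) : Prop :=
  Z.Adj p.1 p.2 ∧ Z.Adj q.1 q.2 ∧ Z.Adj p.1 q.1 ∧ Z.Adj p.2 q.2 ∧ p.1 ≠ q.2 ∧ p.2 ≠ q.1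

/-- Parallelism of edges, regardless of orientation. -/
def Parallel (Z : SimpleGraph V) : V × V → V × V → Prop :=
  Relation.EqvGen fun p q => Opposite Z p q ∨ q = p.swap

/-- Hyperplanes are parallelism classes of edges; an edge is seen here as a pair of mutually reverse
oriented edges. -/
def IsHyperplane (Z : SimpleGraph V) (H : Set (V × V)) : Prop :=
  ∃ p : V × V, Z.Adj p.1 p.2 ∧ H = {q | Parallel Z p q}

/-- `x` and `y` are joined by an edge path with no edge dual to `H`. -/
def SameSide (Z : SimpleGraph V) (H : Set (V × V)) : V → V → Prop :=
  Relation.ReflTransGen fun x y => Z.Adj x y ∧ (x, y) ∉ H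

/-- Halfspaces of `H` (as sets of vertices): connected components of the complement of the open
carrier of `H`. -/
def IsHalfspace (Z : SimpleGraph V) (H : Set (V × V)) (S : Set V) : Prop :=
  ∃ x, S = {y | SameSide Z H x y}

/-- The vertices of the carrier of `H`: each vertex of a cube which contains an edge dual to `H` is
itself an endpoint of an edge dual to `H`. -/
def carrier (H : Set (V × V)) : Set V := {x | ∃ y, (x, y) ∈ H}

/-- Transverse hyperplanes have dual edges that span a square. -/
def Transverse (Z : SimpleGraph V) (H K : Set (V × V)) : Prop :=
  ∃ a b c d : V, Opposite Z (a, b) (c, d) ∧ (a, b) ∈ H ∧ (a, c) ∈ K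

/-- The separator of two sets of vertices. -/
def separator (Z : SimpleGraph V) (A B : Set V) : Set (Set (V × V)) :=
  {K | IsHyperplane Z K ∧ ∃ S T, IsHalfspace Z K S ∧ IsHalfspace Z K T ∧ S ≠ T ∧ A ⊆ S ∧ B ⊆ T}

end CAT0

/-! ## Group actions -/

section Action

variable (G : Type v) [Group G] {V : Type u} [MulAction G V]

/-- `G` acts on `Z` by combinatorial isometries. -/
def IsIsometric (Z : SimpleGraph V) : Prop := ∀ (g : G) (x y : V), Z.Adj (g • x) (g • y) ↔ Z.Adj x y

/-- `G` acts freely on the cube complex `Z`: a nontrivial element fixes no point, equivalently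
stabilizes no cube. -/
def IsFree (Z : SimpleGraph V) : Prop :=
  ∀ (g : G) (n : ℕ) (c : (Fin n → Bool) → V), IsCube Z c → g • Set.range c = Set.range c → g = 1

/-- The quotient cube complex `Z/G`: its parametrized cubes are the `G`-orbits of parametrized cubes
of `Z`. -/
noncomputable def quotient (Z : SimpleGraph V) : CubicalSet.{u} where
  Cell n := Quot fun c c' : {c : (Fin n → Bool) → V // IsCube Z c} =>
    ∃ g : G, ∀ x, g • c.1 x = c'.1 x
  face f := Quot.map
    (fun c => ⟨fun x => c.1 (f.app x), fun x y => by rw [c.2, FaceMap.hammingDist_app]⟩)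
    (by
      rintro c c' ⟨g, h⟩
      exact ⟨g, fun x => h _⟩)
  face_idm := by
    rintro n ⟨c⟩
    simp only [Quot.map, FaceMap.app_idm]
  face_comp := by
    rintro k m n g f ⟨c⟩
    simp only [Quot.map, FaceMap.app_comp]

/-- A free action by combinatorial isometries on a CAT(0) cube complex. -/
structure IsFreeCAT0Action (Z : SimpleGraph V) : Prop where
  median : IsMedian Z
  isometric : IsIsometric G Z
  free : IsFree G Z

/-- A free cocompact action by combinatorial isometries on a CAT(0) cube complex. -/
structure IsGeometric (Z : SimpleGraph V) : Prop extends IsFreeCAT0Action G Z where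
  cocompact : (quotient G Z).IsCompact

/-- Cospecial actions. -/
structure IsCospecial (Z : SimpleGraph V) : Prop extends IsFreeCAT0Action G Z where
  two_sided : ∀ (g : G) (H : Set (V × V)), IsHyperplane Z H → g • H = H →
    ∀ S, IsHalfspace Z H S → g • S = S
  no_self_intersection : ∀ (g : G) (H : Set (V × V)), IsHyperplane Z H → ¬ Transverse Z H (g • H)
  no_direct_self_osculation : ∀ (g : G) (H : Set (V × V)), IsHyperplane Z H →
    (carrier H ∩ carrier (g • H)).Nonempty → ∀ S, IsHalfspace Z H S → (S ∩ g • S).Nonempty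
  no_inter_osculation : ∀ (g : G) (H K : Set (V × V)), IsHyperplane Z H → IsHyperplane Z K →
    Transverse Z H K → (carrier (g • H) ∩ carrier K).Nonempty → Transverse Z (g • H) K

/-- `𝓗` is a `G`-invariant family of hyperplanes of `Z`. -/
structure IsInvariantFamily (Z : SimpleGraph V) (𝓗 : Set (Set (V × V))) : Prop where
  hyperplane : ∀ H ∈ 𝓗, IsHyperplane Z H
  invariant : ∀ (g : G), ∀ H ∈ 𝓗, g • H ∈ 𝓗

/-- Strongly collapsible families of hyperplanes. -/
structure IsStronglyCollapsible (Z : SimpleGraph V) (𝓗 : Set (Set (V × V))) : Prop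
    extends IsInvariantFamily G Z 𝓗 where
  strong : ∀ H ∈ 𝓗, ∀ g : G, g • H ≠ H → ¬ separator Z (carrier H) (carrier (g • H)) ⊆ 𝓗

end Action

/-! ## Sageev's construction and collapses -/

section Sageev

variable {E : Type u}

/-- The vertices of the cube complex dual to a wallspace structure on `E`. The walls are the
partitions `{h, hᶜ}` with `h ∈ 𝓢`, and a vertex is a choice of one part in each partition. -/
@[ext]
structure DualVertex (𝓢 : Set (Set E)) where
  parts : Set (Set E)
  subset : parts ⊆ 𝓢
  choice : ∀ h ∈ 𝓢, Xor (h ∈ parts) (hᶜ ∈ parts)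
  inter : ∀ h ∈ parts, ∀ k ∈ parts, (h ∩ k).Nonempty
  finite : ∀ x : E, {h ∈ parts | x ∉ h}.Finite

/-- The `1`-skeleton of the cube complex dual to a wallspace: two vertices are adjacent when they
have the same chosen parts for all partitions except one. -/
def dualGraph (𝓢 : Set (Set E)) : SimpleGraph (DualVertex 𝓢) where
  Adj σ τ := ∃ h, σ.parts \ τ.parts = {h} ∧ τ.parts \ σ.parts = {hᶜ}
  symm := ⟨by
    rintro σ τ ⟨h, h₁, h₂⟩
    exact ⟨hᶜ, h₂, by rw [h₁, compl_compl]⟩⟩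
  loopless := ⟨by
    rintro σ ⟨h, h₁, -⟩
    rw [Set.sdiff_self] at h₁
    exact Set.singleton_ne_empty h h₁.symm⟩

/-- The action induced on the cube complex dual to a wallspace by an action preserving the walls. -/
abbrev dualAction {G : Type v} [Group G] [MulAction G E] {𝓢 : Set (Set E)}
    (h𝓢 : ∀ (g : G), ∀ h ∈ 𝓢, g • h ∈ 𝓢) : MulAction G (DualVertex 𝓢) where
  smul g σ :=
    { parts := g • σ.parts
      subset := by
        rintro _ ⟨h, hh, rfl⟩
        exact h𝓢 g h (σ.subset hh)
      choice := by
        intro h hh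
        rw [Set.mem_smul_set_iff_inv_smul_mem, Set.mem_smul_set_iff_inv_smul_mem,
          Set.smul_set_compl]
        exact σ.choice _ (h𝓢 _ _ hh)
      inter := by
        rintro _ ⟨h, hh, rfl⟩ _ ⟨k, hk, rfl⟩
        obtain ⟨x, hx, hx'⟩ := σ.inter h hh k hk
        exact ⟨g • x, Set.smul_mem_smul_set hx, Set.smul_mem_smul_set hx'⟩
      finite := by
        intro x
        refine ((σ.finite (g⁻¹ • x)).image fun h => g • h).subset ?_
        rintro _ ⟨⟨h, hh, rfl⟩, hx⟩
        exact ⟨h, ⟨hh, fun h' => hx (Set.mem_smul_set_iff_inv_smul_mem.2 h')⟩, rfl⟩ }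
  one_smul σ := DualVertex.ext (one_smul G σ.parts)
  mul_smul g k σ := DualVertex.ext (mul_smul g k σ.parts)

variable {V : Type u}

/-- The halfspaces of the hyperplanes of `Z` that do not belong to `𝓗`. -/
def remainingHalfspaces (Z : SimpleGraph V) (𝓗 : Set (Set (V × V))) : Set (Set V) :=
  {S | ∃ H, IsHyperplane Z H ∧ H ∉ 𝓗 ∧ IsHalfspace Z H S}

/-- The range of the collapse of `𝓗`: the restriction quotient of `Z` associated with the hyperplanes
that do not belong to `𝓗`. -/
abbrev collapse (Z : SimpleGraph V) (𝓗 : Set (Set (V × V))) :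
    SimpleGraph (DualVertex (remainingHalfspaces Z 𝓗)) :=
  dualGraph (remainingHalfspaces Z 𝓗)

section Equivariance

variable {G : Type v} [Group G] [MulAction G V] {Z : SimpleGraph V}

theorem Parallel.smul (hZ : IsIsometric G Z) (g : G) {p q : V × V} (h : Parallel Z p q) :
    Parallel Z (g • p) (g • q) := by
  induction h with
  | rel p q h =>
    refine Relation.EqvGen.rel _ _ ?_
    rcases h with ⟨h1, h2, h3, h4, h5, h6⟩ | rfl
    · exact Or.inl ⟨(hZ g _ _).2 h1, (hZ g _ _).2 h2, (hZ g _ _).2 h3, (hZ g _ _).2 h4,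
        fun h => h5 (MulAction.injective g h), fun h => h6 (MulAction.injective g h)⟩
    · exact Or.inr rfl
  | refl p => exact Relation.EqvGen.refl _
  | symm p q _ ih => exact Relation.EqvGen.symm _ _ ih
  | trans p q r _ _ ih₁ ih₂ => exact Relation.EqvGen.trans _ _ _ ih₁ ih₂

theorem IsHyperplane.smul (hZ : IsIsometric G Z) (g : G) {H : Set (V × V)}
    (h : IsHyperplane Z H) : IsHyperplane Z (g • H) := by
  obtain ⟨p, hp, rfl⟩ := h
  refine ⟨g • p, (hZ g _ _).2 hp, ?_⟩
  ext q
  rw [Set.mem_smul_set_iff_inv_smul_mem]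
  constructor
  · intro h
    have := Parallel.smul hZ g h
    rwa [smul_inv_smul] at this
  · intro h
    have := Parallel.smul hZ g⁻¹ h
    rwa [inv_smul_smul] at this

theorem SameSide.smul (hZ : IsIsometric G Z) (g : G) {H : Set (V × V)} {x y : V}
    (h : SameSide Z H x y) : SameSide Z (g • H) (g • x) (g • y) := by
  unfold SameSide at h
  induction h with
  | refl => exact Relation.ReflTransGen.refl
  | @tail a b _ hab ih =>
    refine Relation.ReflTransGen.tail ih ⟨(hZ g _ _).2 hab.1, fun h' => hab.2 ?_⟩
    have : g • (a, b) ∈ g • H := h'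
    exact Set.smul_mem_smul_set_iff.1 this

theorem IsHalfspace.smul (hZ : IsIsometric G Z) (g : G) {H : Set (V × V)} {S : Set V}
    (h : IsHalfspace Z H S) : IsHalfspace Z (g • H) (g • S) := by
  obtain ⟨x, rfl⟩ := h
  refine ⟨g • x, ?_⟩
  ext y
  rw [Set.mem_smul_set_iff_inv_smul_mem]
  constructor
  · intro h
    have := SameSide.smul hZ g h
    rwa [smul_inv_smul] at this
  · intro h
    have := SameSide.smul hZ g⁻¹ h
    rwa [inv_smul_smul, inv_smul_smul] at this

theorem remainingHalfspaces_smul (hZ : IsIsometric G Z) {𝓗 : Set (Set (V × V))}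
    (h𝓗 : IsInvariantFamily G Z 𝓗) (g : G) :
    ∀ S ∈ remainingHalfspaces Z 𝓗, g • S ∈ remainingHalfspaces Z 𝓗 := by
  rintro S ⟨H, hH, hn, hS⟩
  refine ⟨g • H, hH.smul hZ g, fun h => hn ?_, hS.smul hZ g⟩
  have := h𝓗.invariant g⁻¹ _ h
  rwa [inv_smul_smul] at this

/-- The action of `G` on the range of the collapse of an invariant family of hyperplanes. -/
abbrev collapseAction (hZ : IsIsometric G Z) {𝓗 : Set (Set (V × V))}
    (h𝓗 : IsInvariantFamily G Z 𝓗) : MulAction G (DualVertex (remainingHalfspaces Z 𝓗)) :=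
  dualAction (remainingHalfspaces_smul hZ h𝓗)

end Equivariance

end Sageev

/-! ## Right-angled Artin groups, Salvetti complexes, cospatial actions -/

section RAAG

variable {W : Type v} (Γ : SimpleGraph W)

/-- The right-angled Artin group of a graph. -/
abbrev RAAG : Type v :=
  PresentedGroup {r : FreeGroup W | ∃ a b : W, Γ.Adj a b ∧
    r = FreeGroup.of a * FreeGroup.of b * (FreeGroup.of a)⁻¹ * (FreeGroup.of b)⁻¹}

/-- The Salvetti complex, the subcomplex of the torus `(S¹)^W` whose cubes correspond to cliques
of `Γ`. A parametrized `n`-cube is given by an ordered clique of size `n`, and an orientation of each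
of the corresponding directions of the torus. -/
def salvetti : CubicalSet.{v} where
  Cell n := {c : Fin n → W × Bool // ∀ i j, i ≠ j → Γ.Adj (c i).1 (c j).1}
  face f c := ⟨fun i => ((c.1 (f.dir i)).1, xor (c.1 (f.dir i)).2 (f.base (f.dir i))),
    fun i j hij => c.2 _ _ fun h => hij (f.dir.injective h)⟩
  face_idm := by
    rintro n ⟨c, hc⟩
    simp [FaceMap.idm]
  face_comp := by
    rintro k m n g f ⟨c, hc⟩
    simp only [FaceMap.comp, Function.Embedding.trans_apply, FaceMap.app_dir, Bool.xor_assoc]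

variable {V : Type u}

/-- Salvetti-like actions of a right-angled Artin group. -/
structure IsSalvettiLike (Z : SimpleGraph V) [MulAction (RAAG Γ) V] : Prop
    extends IsGeometric (RAAG Γ) Z where
  iso : Nonempty (CubicalSet.Iso (quotient (RAAG Γ) Z) (salvetti Γ))

/-- Cospatial actions of a right-angled Artin group. -/
structure IsCospatial (Z : SimpleGraph V) [MulAction (RAAG Γ) V] : Prop
    extends IsGeometric (RAAG Γ) Z where
  no_redundant_pair : ¬ ∃ H₁ H₂, (quotient (RAAG Γ) Z).IsRedundantPair H₁ H₂
  exists_collapse : ∀ H, IsHyperplane Z H →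
    ∃ (𝓗 : Set (Set (V × V))) (h𝓗 : IsStronglyCollapsible (RAAG Γ) Z 𝓗), H ∉ 𝓗 ∧
      letI := collapseAction isometric h𝓗.toIsInvariantFamily
      IsSalvettiLike Γ (collapse Z 𝓗)

end RAAG

/-- Spatial cube complexes: quotients of cospatial actions of right-angled Artin groups (of finite
non-empty graphs). -/
def IsSpatial (X : CubicalSet.{u}) : Prop :=
  ∃ (W : Type u) (_ : Finite W) (_ : Nonempty W) (Γ : SimpleGraph W)
    (V : Type u) (Z : SimpleGraph V) (_ : MulAction (RAAG Γ) V),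
    IsCospatial Γ Z ∧ Nonempty (CubicalSet.Iso X (quotient (RAAG Γ) Z))

/-- Special cube complexes: quotients of cospecial actions. -/
def IsSpecial (X : CubicalSet.{u}) : Prop :=
  ∃ (G : Type u) (_ : Group G) (V : Type u) (Z : SimpleGraph V) (_ : MulAction G V),
    IsCospecial G Z ∧ Nonempty (CubicalSet.Iso X (quotient G Z))

/-- The `1`-skeleton of the standard cubical subdivision of the plane. -/
noncomputable abbrev squareGrid : SimpleGraph (ℤ × ℤ) := (SimpleGraph.hasse ℤ).boxProd (SimpleGraph.hasse ℤ)

/-- The graph with two adjacent vertices; its right-angled Artin group is `ℤ²`. -/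
abbrev edgeGraph : SimpleGraph (Fin 2) := ⊤

end CubeCx

open CubeCx

namespace CubeCx

/-! ## Hyperplanes of median graphs -/

section Median

variable {V : Type u} {Z : SimpleGraph V}

/-! Fix a hyperplane `H` and a strong collapse `π : Z → Z'` that keeps `H`, where the quotient of
`Z'` is the Salvetti complex. Every oriented edge of `Z'` then has a label, a generator with a sign.
The Salvetti complex has a single vertex and the action is free, so the group is transitive on the
vertices of `Z'`, and an edge is determined by its origin and its label. Labels are invariant under
the group and under oriented parallelism, and two edges issued from a vertex span a square exactly
when their generators are adjacent in `Γ`. Through `π`, each kept hyperplane of `Z` acquires a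
generator, with a sign once a halfspace is chosen (`IsCollapseMap.label_parallel`,
`IsCollapseMap.label_smul_eq`).

The conditions on `H` follow. An element exchanging the halfspaces would give an edge and its
reverse the same label. If `H` and `gH` were transverse, a generator would be adjacent to itself. If
`H` and `gH` osculated directly, two edges with the same origin and label would coincide in `Z'`,
forcing `gH = H`. For inter-osculation with a hyperplane `K` that is also kept, adjacency of the
generators produces a square in `Z'`, hence transversality in `Z`. If `K` is collapsed it has no
label, and strong collapsibility takes over: the carriers of distinct translates of `K` have
disjoint images (`IsCollapseMap.smul_eq_of_mem_carrier`), so an element bringing the contact point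
over a crossing of `H` and `K` must stabilize `K`.

For the counterexample, translations of the grid preserve the two directions of hyperplanes, and
parallel hyperplanes have nested halfspaces, so the action is cospecial. Opposite corners of a
square lie in one orbit, so in any complex with the same quotient each hyperplane orbit contains two
distinct members with intersecting carriers (`exists_adjacent_smul_hyperplane`). Hence only the
empty family is strongly collapsible. Its collapse identifies no two vertices, whereas the quotient
has two vertices (the parities) and a Salvetti complex has one.

On the side of `Z`, everything rests on describing halfspaces of a median graph as the sets `nearer
Z a b`. -/

/-- The vertices that are nearer to `a` than to `b`. -/
def nearer (Z : SimpleGraph V) (a b : V) : Set V := {x | Z.dist x a < Z.dist x b}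

theorem IsMedian.dist_adj (hZ : IsMedian Z) {a b : V} (hab : Z.Adj a b) (x : V) :
    Z.dist x b = Z.dist x a + 1 ∨ Z.dist x a = Z.dist x b + 1 := by
  obtain ⟨m, ⟨h1, h2, h3⟩, -⟩ := hZ.2 a b x
  have hd : Z.dist a b = 1 := SimpleGraph.dist_eq_one_iff_adj.2 hab
  have : Z.dist a m = 0 ∨ Z.dist m b = 0 := by omega
  rcases this with h | h
  · obtain rfl := hZ.1.dist_eq_zero_iff.1 h
    left
    rw [Z.dist_comm (u := x), Z.dist_comm (u := x), h2, Z.dist_comm (u := b), hd, add_comm]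
  · obtain rfl := hZ.1.dist_eq_zero_iff.1 h
    right
    rw [Z.dist_comm (u := x), Z.dist_comm (u := x), h3, hd, add_comm]

theorem exists_adj_dist_eq (hZ : Z.Connected) {x y : V} {n : ℕ} (h : Z.dist x y = n + 1) :
    ∃ z, Z.Adj x z ∧ Z.dist z y = n := by
  obtain ⟨w, hw⟩ := hZ.exists_walk_length_eq_dist x y
  cases w with
  | nil => simp at h
  | @cons _ z _ hxz w =>
    refine ⟨z, hxz, le_antisymm ?_ ?_⟩
    · have := SimpleGraph.dist_le w
      simp only [SimpleGraph.Walk.length_cons] at hw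
      omega
    · have := hZ.dist_triangle (u := x) (v := z) (w := y)
      rw [SimpleGraph.dist_eq_one_iff_adj.2 hxz] at this
      omega

theorem IsMedian.not_mem_nearer_iff (hZ : IsMedian Z) {a b : V} (hab : Z.Adj a b) (x : V) :
    x ∉ nearer Z a b ↔ x ∈ nearer Z b a := by
  have := hZ.dist_adj hab x
  simp only [nearer, Set.mem_ofPred_eq]
  omega

theorem left_mem_nearer {a b : V} (hab : Z.Adj a b) : a ∈ nearer Z a b := by
  simp [nearer, SimpleGraph.dist_eq_one_iff_adj.2 hab]

theorem Opposite.symm {p q : V × V} (h : Opposite Z p q) : Opposite Z q p :=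
  ⟨h.2.1, h.1, h.2.2.1.symm, h.2.2.2.1.symm, h.2.2.2.2.2.symm, h.2.2.2.2.1.symm⟩

theorem Opposite.swap {p q : V × V} (h : Opposite Z p q) : Opposite Z p.swap q.swap :=
  ⟨h.1.symm, h.2.1.symm, h.2.2.2.1, h.2.2.1, h.2.2.2.2.2, h.2.2.2.2.1⟩

theorem Opposite.transpose {a b c d : V} (h : Opposite Z (a, b) (c, d)) :
    Opposite Z (a, c) (b, d) :=
  ⟨h.2.2.1, h.2.2.2.1, h.1, h.2.1, h.2.2.2.2.1, h.2.2.2.2.2.symm⟩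

/-- If `x` were nearer to `a` than to `b` but nearer to `d` than to `c`, the distances would make
both `a` and `d` medians of `b`, `c`, `x`, contradicting uniqueness. -/
theorem IsMedian.nearer_subset_of_opposite (hZ : IsMedian Z) {p q : V × V}
    (h : Opposite Z p q) : nearer Z p.1 p.2 ⊆ nearer Z q.1 q.2 := by
  obtain ⟨a, b⟩ := p
  obtain ⟨c, d⟩ := q
  obtain ⟨hab, hcd, hac, hbd, had, hbc⟩ := h
  simp only at hab hcd hac hbd had hbc
  intro x hx
  simp only [nearer, Set.mem_ofPred_eq] at hx ⊢
  by_contra hn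
  have h1 := hZ.dist_adj hab x
  have h2 := hZ.dist_adj hcd x
  have h3 := hZ.dist_adj hac x
  have h4 := hZ.dist_adj hbd x
  have hbc2 : Z.dist b c = 2 := by
    have e1 := hZ.dist_adj hac b
    have e2 : Z.dist b a = 1 := SimpleGraph.dist_eq_one_iff_adj.2 hab.symm
    have e3 : Z.dist b c ≠ 0 := fun h => hbc (hZ.1.dist_eq_zero_iff.1 h)
    omega
  obtain ⟨m, -, hm⟩ := hZ.2 b c x
  refine had ((hm a ⟨?_, ?_, ?_⟩).trans (hm d ⟨?_, ?_, ?_⟩).symm)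
  · rw [hbc2, SimpleGraph.dist_eq_one_iff_adj.2 hab.symm, SimpleGraph.dist_eq_one_iff_adj.2 hac]
  · rw [SimpleGraph.dist_eq_one_iff_adj.2 hac.symm, Z.dist_comm (u := c), Z.dist_comm (u := a)]
    omega
  · rw [SimpleGraph.dist_eq_one_iff_adj.2 hab.symm, Z.dist_comm (u := b), Z.dist_comm (u := a)]
    omega
  · rw [hbc2, SimpleGraph.dist_eq_one_iff_adj.2 hbd, SimpleGraph.dist_eq_one_iff_adj.2 hcd.symm]
  · rw [SimpleGraph.dist_eq_one_iff_adj.2 hcd, Z.dist_comm (u := c), Z.dist_comm (u := d)]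
    omega
  · rw [SimpleGraph.dist_eq_one_iff_adj.2 hbd, Z.dist_comm (u := b), Z.dist_comm (u := d)]
    omega

theorem IsMedian.nearer_eq_of_opposite (hZ : IsMedian Z) {p q : V × V}
    (h : Opposite Z p q) : nearer Z p.1 p.2 = nearer Z q.1 q.2 :=
  (hZ.nearer_subset_of_opposite h).antisymm (hZ.nearer_subset_of_opposite h.symm)

theorem Parallel.adj_iff {p q : V × V} (h : Parallel Z p q) :
    Z.Adj p.1 p.2 ↔ Z.Adj q.1 q.2 := by
  induction h with
  | rel p q h =>
    rcases h with h | rfl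
    · exact iff_of_true h.1 h.2.1
    · exact Z.adj_comm _ _
  | refl p => exact Iff.rfl
  | symm p q _ ih => exact ih.symm
  | trans p q r _ _ ih₁ ih₂ => exact ih₁.trans ih₂

theorem IsMedian.nearer_eq_of_parallel (hZ : IsMedian Z) {p q : V × V} (h : Parallel Z p q) :
    (nearer Z p.1 p.2 = nearer Z q.1 q.2 ∧ nearer Z p.2 p.1 = nearer Z q.2 q.1) ∨
      (nearer Z p.1 p.2 = nearer Z q.2 q.1 ∧ nearer Z p.2 p.1 = nearer Z q.1 q.2) := by
  induction h with
  | rel p q h =>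
    rcases h with h | rfl
    · exact Or.inl ⟨hZ.nearer_eq_of_opposite h, hZ.nearer_eq_of_opposite h.swap⟩
    · exact Or.inr ⟨rfl, rfl⟩
  | refl p => exact Or.inl ⟨rfl, rfl⟩
  | symm p q _ ih => grind
  | trans p q r _ _ ih₁ ih₂ => grind

/-- Induction on the distance from `a` to `c`: one step along a geodesic towards `c` pushes the edge
`ab` across a square. -/
theorem IsMedian.parallel_of_mem_nearer (hZ : IsMedian Z) {a b c d : V} (hab : Z.Adj a b)
    (hcd : Z.Adj c d) (hc : c ∈ nearer Z a b) (hd : d ∈ nearer Z b a) :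
    Parallel Z (a, b) (c, d) := by
  obtain ⟨n, hn⟩ : ∃ n, Z.dist a c = n := ⟨_, rfl⟩
  induction n generalizing a b with
  | zero =>
    obtain rfl := hZ.1.dist_eq_zero_iff.1 hn
    simp only [nearer, Set.mem_ofPred_eq, SimpleGraph.dist_eq_one_iff_adj.2 hcd.symm] at hd
    obtain rfl := hZ.1.dist_eq_zero_iff.1 (Nat.lt_one_iff.1 hd)
    exact Relation.EqvGen.refl _
  | succ n ih =>
    obtain ⟨a', haa', ha'⟩ := exists_adj_dist_eq hZ.1 hn
    simp only [nearer, Set.mem_ofPred_eq] at hc hd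
    have e1 := hZ.dist_adj hab c
    have e2 := hZ.dist_adj hab d
    have e3 := hZ.dist_adj hcd a
    have e4 := hZ.dist_adj hcd b
    have e5 := hZ.dist_adj hcd a'
    have e6 := hZ.dist_adj haa' d
    have e7 := hZ.dist_adj haa' b
    have c1 := Z.dist_comm (u := a) (v := c)
    have c2 := Z.dist_comm (u := b) (v := c)
    have c3 := Z.dist_comm (u := a) (v := d)
    have c4 := Z.dist_comm (u := b) (v := d)
    have c5 := Z.dist_comm (u := a') (v := d)
    have hba := SimpleGraph.dist_eq_one_iff_adj.2 hab.symm
    have hba' : b ≠ a' := by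
      rintro rfl
      omega
    have h0 : Z.dist b a' ≠ 0 := fun h => hba' (hZ.1.dist_eq_zero_iff.1 h)
    -- Both `b` and `a'` are at distance `n + 1` from `d` and at distance 2 from each other, so
    -- their median with `d` is the missing corner of the square.
    obtain ⟨b', ⟨m1, m2, m3⟩, -⟩ := hZ.2 b a' d
    have c6 := Z.dist_comm (u := a') (v := b')
    have hbb' : Z.Adj b b' := SimpleGraph.dist_eq_one_iff_adj.1 (by omega)
    have hab' : Z.Adj a' b' := SimpleGraph.dist_eq_one_iff_adj.1 (by omega)
    have hne : a ≠ b' := by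
      rintro rfl
      omega
    have hop : Opposite Z (a, b) (a', b') := ⟨hab, hab', haa', hbb', hne, hba'⟩
    refine Relation.EqvGen.trans _ _ _ (Relation.EqvGen.rel _ _ (Or.inl hop)) (ih hab' ?_ ?_ ha')
    · exact hZ.nearer_subset_of_opposite hop hc
    · exact hZ.nearer_subset_of_opposite hop.swap hd

theorem Parallel.swap (p : V × V) : Parallel Z p p.swap := Relation.EqvGen.rel _ _ (Or.inr rfl)

/-- This replaces the inductively generated parallelism by a condition on distances; all later facts
on hyperplanes go through it. -/
theorem IsMedian.parallel_iff (hZ : IsMedian Z) {a b x y : V} (hab : Z.Adj a b) :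
    Parallel Z (a, b) (x, y) ↔ Z.Adj x y ∧ (x ∈ nearer Z a b ↔ y ∉ nearer Z a b) := by
  constructor
  · intro h
    have hxy : Z.Adj x y := h.adj_iff.1 hab
    refine ⟨hxy, ?_⟩
    rcases hZ.nearer_eq_of_parallel h with ⟨h1, h2⟩ | ⟨h1, h2⟩ <;> simp only at h1 h2
    · rw [h1, hZ.not_mem_nearer_iff hxy]
      exact iff_of_true (left_mem_nearer hxy) (left_mem_nearer hxy.symm)
    · rw [h1, ← not_iff_not, not_not, hZ.not_mem_nearer_iff hxy.symm]
      exact iff_of_true (left_mem_nearer hxy) (left_mem_nearer hxy.symm)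
  · rintro ⟨hxy, h⟩
    by_cases hx : x ∈ nearer Z a b
    · exact hZ.parallel_of_mem_nearer hab hxy hx ((hZ.not_mem_nearer_iff hab _).1 (h.1 hx))
    · have hy : y ∈ nearer Z a b := by
        by_contra hy
        exact hx (h.2 hy)
      exact Relation.EqvGen.trans _ _ _
        (hZ.parallel_of_mem_nearer hab hxy.symm hy ((hZ.not_mem_nearer_iff hab _).1 hx))
        (Parallel.swap _)

theorem SameSide.symm {H : Set (V × V)} (hH : ∀ x y, (x, y) ∈ H → (y, x) ∈ H) {x y : V}
    (h : SameSide Z H x y) : SameSide Z H y x := by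
  induction h with
  | refl => exact Relation.ReflTransGen.refl
  | tail _ hab ih => exact Relation.ReflTransGen.head ⟨hab.1.symm, fun h => hab.2 (hH _ _ h)⟩ ih

theorem IsMedian.sameSide_left (hZ : IsMedian Z) {a b : V} (hab : Z.Adj a b) {x : V}
    (hx : x ∈ nearer Z a b) : SameSide Z {q | Parallel Z (a, b) q} x a := by
  obtain ⟨n, hn⟩ : ∃ n, Z.dist x a = n := ⟨_, rfl⟩
  induction n generalizing x with
  | zero =>
    obtain rfl := hZ.1.dist_eq_zero_iff.1 hn
    exact Relation.ReflTransGen.refl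
  | succ n ih =>
    obtain ⟨z, hxz, hz⟩ := exists_adj_dist_eq hZ.1 hn
    have hz' : z ∈ nearer Z a b := by
      simp only [nearer, Set.mem_ofPred_eq] at hx ⊢
      have e1 := hZ.dist_adj hxz b
      have e2 := Z.dist_comm (u := b) (v := x)
      have e3 := Z.dist_comm (u := b) (v := z)
      omega
    refine Relation.ReflTransGen.head ⟨hxz, fun h => ?_⟩ (ih hz' hz)
    exact ((hZ.parallel_iff hab).1 h).2.1 hx hz'

theorem IsMedian.sameSide_iff (hZ : IsMedian Z) {a b : V} (hab : Z.Adj a b) {x y : V} :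
    SameSide Z {q | Parallel Z (a, b) q} x y ↔ (x ∈ nearer Z a b ↔ y ∈ nearer Z a b) := by
  constructor
  · intro h
    induction h with
    | refl => exact Iff.rfl
    | @tail y z _ hyz ih =>
      have h1 := hyz.2
      rw [Set.mem_ofPred_eq, hZ.parallel_iff hab] at h1
      have := hyz.1
      tauto
  · intro h
    have hs : ∀ x y, (x, y) ∈ {q | Parallel Z (a, b) q} → (y, x) ∈ {q | Parallel Z (a, b) q} :=
      fun x y h => Relation.EqvGen.trans _ _ _ h (Parallel.swap _)
    by_cases hx : x ∈ nearer Z a b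
    · exact (hZ.sameSide_left hab hx).trans (SameSide.symm hs (hZ.sameSide_left hab (h.1 hx)))
    · have e : {q | Parallel Z (a, b) q} = {q | Parallel Z (b, a) q} := by
        ext q
        exact ⟨fun h => Relation.EqvGen.trans _ _ _ (Parallel.swap _) h,
          fun h => Relation.EqvGen.trans _ _ _ (Parallel.swap _) h⟩
      have hy : y ∉ nearer Z a b := fun hy => hx (h.2 hy)
      rw [hZ.not_mem_nearer_iff hab] at hx hy
      rw [e] at hs ⊢
      exact (hZ.sameSide_left hab.symm hx).trans (SameSide.symm hs (hZ.sameSide_left hab.symm hy))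

end Median

/-! ### Convexity of halfspaces, carriers and transversality. -/

section Halfspaces

variable {V : Type u} {Z : SimpleGraph V} {H K : Set (V × V)} {S T : Set V}

theorem IsMedian.exists_eq_nearer (hZ : IsMedian Z) (hH : IsHyperplane Z H)
    (hS : IsHalfspace Z H S) :
    ∃ a b, Z.Adj a b ∧ H = {q | Parallel Z (a, b) q} ∧ S = nearer Z a b := by
  obtain ⟨⟨a, b⟩, hab, rfl⟩ := hH
  obtain ⟨x, rfl⟩ := hS
  simp only at hab
  by_cases hx : x ∈ nearer Z a b
  · refine ⟨a, b, hab, rfl, ?_⟩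
    ext y
    simp [hZ.sameSide_iff hab, hx]
  · refine ⟨b, a, hab.symm, ?_, ?_⟩
    · ext q
      exact ⟨fun h => Relation.EqvGen.trans _ _ _ (Parallel.swap _) h,
        fun h => Relation.EqvGen.trans _ _ _ (Parallel.swap _) h⟩
    · ext y
      simp [hZ.sameSide_iff hab, hx, hZ.not_mem_nearer_iff hab]

theorem IsMedian.isHalfspace_nearer (hZ : IsMedian Z) {a b : V} (hab : Z.Adj a b) :
    IsHalfspace Z {q | Parallel Z (a, b) q} (nearer Z a b) := by
  refine ⟨a, ?_⟩
  ext y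
  simp [hZ.sameSide_iff hab, left_mem_nearer hab]

theorem IsHyperplane.of_adj {a b : V} (hab : Z.Adj a b) :
    IsHyperplane Z {q | Parallel Z (a, b) q} := ⟨(a, b), hab, rfl⟩

theorem IsHyperplane.swap_mem (hH : IsHyperplane Z H) {x y : V} (h : (x, y) ∈ H) :
    (y, x) ∈ H := by
  obtain ⟨p, -, rfl⟩ := hH
  exact Relation.EqvGen.trans _ _ _ h (Parallel.swap _)

theorem IsHyperplane.eq_of_mem (hH : IsHyperplane Z H) {p : V × V} (h : p ∈ H) :
    H = {q | Parallel Z p q} := by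
  obtain ⟨r, -, rfl⟩ := hH
  ext q
  exact ⟨fun h' => Relation.EqvGen.trans _ _ _ (Relation.EqvGen.symm _ _ h) h',
    fun h' => Relation.EqvGen.trans _ _ _ h h'⟩

theorem IsHyperplane.eq_of_mem_of_mem (hH : IsHyperplane Z H) (hK : IsHyperplane Z K) {p : V × V}
    (h : p ∈ H) (h' : p ∈ K) : H = K :=
  (hH.eq_of_mem h).trans (hK.eq_of_mem h').symm

theorem IsHyperplane.adj (hH : IsHyperplane Z H) {x y : V} (h : (x, y) ∈ H) : Z.Adj x y := by
  obtain ⟨r, hr, rfl⟩ := hH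
  exact (Parallel.adj_iff h).1 hr

theorem IsHyperplane.mem_of_opposite (hH : IsHyperplane Z H) {p q : V × V} (hp : p ∈ H)
    (h : Opposite Z p q) : q ∈ H := by
  obtain ⟨r, hr, rfl⟩ := hH
  exact Relation.EqvGen.trans _ _ _ hp (Relation.EqvGen.rel _ _ (Or.inl h))

theorem IsHyperplane.nonempty (hH : IsHyperplane Z H) : ∃ x y, (x, y) ∈ H := by
  obtain ⟨r, hr, rfl⟩ := hH
  exact ⟨r.1, r.2, Relation.EqvGen.refl _⟩

theorem IsMedian.mem_hyperplane_iff (hZ : IsMedian Z) (hH : IsHyperplane Z H)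
    (hS : IsHalfspace Z H S) {x y : V} : (x, y) ∈ H ↔ Z.Adj x y ∧ (x ∈ S ↔ y ∉ S) := by
  obtain ⟨a, b, hab, rfl, rfl⟩ := hZ.exists_eq_nearer hH hS
  exact hZ.parallel_iff hab

theorem IsMedian.mem_iff_of_notMem (hZ : IsMedian Z) (hH : IsHyperplane Z H)
    (hS : IsHalfspace Z H S) {x y : V} (hxy : Z.Adj x y) (h : (x, y) ∉ H) : x ∈ S ↔ y ∈ S := by
  by_contra hc
  exact h ((hZ.mem_hyperplane_iff hH hS).2 ⟨hxy, by tauto⟩)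

theorem IsMedian.isHalfspace_compl (hZ : IsMedian Z) (hH : IsHyperplane Z H)
    (hS : IsHalfspace Z H S) : IsHalfspace Z H Sᶜ := by
  obtain ⟨a, b, hab, rfl, rfl⟩ := hZ.exists_eq_nearer hH hS
  refine ⟨b, ?_⟩
  ext y
  have := (hZ.not_mem_nearer_iff hab b).2 (left_mem_nearer hab.symm)
  simp [hZ.sameSide_iff hab, this]

theorem IsHalfspace.nonempty (hS : IsHalfspace Z H S) : S.Nonempty := by
  obtain ⟨x, rfl⟩ := hS
  exact ⟨x, Relation.ReflTransGen.refl⟩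

theorem IsMedian.eq_or_eq_compl (hZ : IsMedian Z) (hH : IsHyperplane Z H)
    (hS : IsHalfspace Z H S) (hT : IsHalfspace Z H T) : T = S ∨ T = Sᶜ := by
  obtain ⟨a, b, hab, rfl, rfl⟩ := hZ.exists_eq_nearer hH hS
  obtain ⟨x, rfl⟩ := hT
  by_cases hx : x ∈ nearer Z a b
  · left
    ext y
    simp [hZ.sameSide_iff hab, hx]
  · right
    ext y
    simp [hZ.sameSide_iff hab, hx]

theorem IsMedian.hyperplane_eq_of_halfspace (hZ : IsMedian Z) (hH : IsHyperplane Z H)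
    (hK : IsHyperplane Z K) (hS : IsHalfspace Z H S) (hT : IsHalfspace Z K S) : H = K := by
  ext ⟨x, y⟩
  rw [hZ.mem_hyperplane_iff hH hS, hZ.mem_hyperplane_iff hK hT]

theorem IsMedian.eq_nearer (hZ : IsMedian Z) (hH : IsHyperplane Z H)
    (hS : IsHalfspace Z H S) {x y : V} (h : (x, y) ∈ H) (hx : x ∈ S) : S = nearer Z x y := by
  have e := hH.eq_of_mem h
  have h' := hZ.isHalfspace_nearer (hH.adj h)
  rw [← e] at h'
  rcases hZ.eq_or_eq_compl hH hS h' with h' | h'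
  · exact h'.symm
  · have := left_mem_nearer (hH.adj h)
    rw [h'] at this
    exact absurd hx this

/-- The vertex `z` lies on the side of `y`, so it is nearer to `y` than to `x`; being adjacent to
`x`, it equals `y`. -/
theorem IsMedian.edge_unique (hZ : IsMedian Z) (hH : IsHyperplane Z H) {x y z : V}
    (h : (x, y) ∈ H) (h' : (x, z) ∈ H) : y = z := by
  rw [hH.eq_of_mem h, Set.mem_ofPred_eq, hZ.parallel_iff (hH.adj h)] at h'
  have h2 := (hZ.not_mem_nearer_iff (hH.adj h) _).1 (h'.2.1 (left_mem_nearer (hH.adj h)))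
  simp only [nearer, Set.mem_ofPred_eq, SimpleGraph.dist_eq_one_iff_adj.2 h'.1.symm] at h2
  exact (hZ.1.dist_eq_zero_iff.1 (Nat.lt_one_iff.1 h2)).symm

/-- The edge is the first one along a geodesic that leaves `S`; the distance formula records that it
lies on a geodesic. -/
theorem exists_crossing (hZ : Z.Connected) {x y : V} (hx : x ∈ S) (hy : y ∉ S) :
    ∃ c d, Z.Adj c d ∧ c ∈ S ∧ d ∉ S ∧ Z.dist x y = Z.dist x c + 1 + Z.dist d y := by
  obtain ⟨n, hn⟩ : ∃ n, Z.dist x y = n := ⟨_, rfl⟩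
  induction n generalizing x with
  | zero =>
    obtain rfl := hZ.dist_eq_zero_iff.1 hn
    exact absurd hx hy
  | succ n ih =>
    obtain ⟨z, hxz, hz⟩ := exists_adj_dist_eq hZ hn
    by_cases hzS : z ∈ S
    · obtain ⟨c, d, h1, h2, h3, h4⟩ := ih hzS hz
      refine ⟨c, d, h1, h2, h3, ?_⟩
      have e1 := hZ.dist_triangle (u := x) (v := z) (w := c)
      have e2 := hZ.dist_triangle (u := x) (v := c) (w := y)
      have e3 := hZ.dist_triangle (u := c) (v := d) (w := y)
      rw [SimpleGraph.dist_eq_one_iff_adj.2 hxz] at e1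
      rw [SimpleGraph.dist_eq_one_iff_adj.2 h1] at e3
      omega
    · refine ⟨x, z, hxz, hx, hzS, ?_⟩
      rw [SimpleGraph.dist_self]
      omega

/-- Halfspaces are convex. -/
theorem IsMedian.convex (hZ : IsMedian Z) (hH : IsHyperplane Z H) (hS : IsHalfspace Z H S)
    {x y m : V} (hx : x ∈ S) (hy : y ∈ S) (hm : Z.dist x y = Z.dist x m + Z.dist m y) :
    m ∈ S := by
  by_contra hmS
  obtain ⟨c, d, hcd, hc, hd, h⟩ := exists_crossing hZ.1 hx hmS
  have hcdH : (c, d) ∈ H := (hZ.mem_hyperplane_iff hH hS).2 ⟨hcd, by tauto⟩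
  -- The halfspace is now measured by the edge where the geodesic to `m` leaves it: `y` is nearer to
  -- `c` than to `d`, although a geodesic from `x` to `y` passes through `c`, then `d`, then `m`.
  rw [hZ.eq_nearer hH hS hcdH hc] at hy
  simp only [nearer, Set.mem_ofPred_eq] at hy
  have e1 := hZ.1.dist_triangle (u := x) (v := c) (w := y)
  have e2 := hZ.1.dist_triangle (u := d) (v := m) (w := y)
  have c1 := Z.dist_comm (u := y) (v := c)
  have c2 := Z.dist_comm (u := y) (v := d)
  omega

theorem IsMedian.exists_crossing_mem (hZ : IsMedian Z) (hH : IsHyperplane Z H)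
    (hS : IsHalfspace Z H S) (hK : IsHyperplane Z K) (hT : IsHalfspace Z K T)
    {x y : V} (hx : x ∈ S) (hy : y ∉ S) (hxT : x ∈ T) (hyT : y ∈ T) :
    ∃ c d, (c, d) ∈ H ∧ c ∈ S ∧ d ∉ S ∧ c ∈ T ∧ d ∈ T := by
  obtain ⟨c, d, hcd, hc, hd, h⟩ := exists_crossing hZ.1 hx hy
  refine ⟨c, d, (hZ.mem_hyperplane_iff hH hS).2 ⟨hcd, by tauto⟩, hc, hd, ?_, ?_⟩
  · refine hZ.convex hK hT hxT hyT ?_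
    have e1 := hZ.1.dist_triangle (u := x) (v := c) (w := y)
    have e2 := hZ.1.dist_triangle (u := c) (v := d) (w := y)
    rw [SimpleGraph.dist_eq_one_iff_adj.2 hcd] at e2
    omega
  · refine hZ.convex hK hT hxT hyT ?_
    have e1 := hZ.1.dist_triangle (u := x) (v := d) (w := y)
    have e2 := hZ.1.dist_triangle (u := x) (v := c) (w := d)
    rw [SimpleGraph.dist_eq_one_iff_adj.2 hcd] at e2
    omega

/-- When a dual edge of `H` slides across a square, its origin changes side of `K` only if the
lateral edges are dual to `K`, which is transversality. Reversing the edge changes side only if `H =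
K`. -/
theorem mem_iff_of_not_transverse (hZ : IsMedian Z) (hH : IsHyperplane Z H)
    (hK : IsHyperplane Z K) (hT : IsHalfspace Z K T) (hne : H ≠ K) (hn : ¬ Transverse Z H K)
    {p q : V × V} (hp : p ∈ H) (hpq : Parallel Z p q) : p.1 ∈ T ↔ q.1 ∈ T := by
  induction hpq with
  | rel p q h =>
    rcases h with h | rfl
    · by_contra hc
      refine hn ⟨p.1, p.2, q.1, q.2, h, hp, ?_⟩
      exact (hZ.mem_hyperplane_iff hK hT).2 ⟨h.2.2.1, by tauto⟩
    · by_contra hc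
      refine hne (hH.eq_of_mem_of_mem hK hp ?_)
      exact (hZ.mem_hyperplane_iff hK hT).2 ⟨hH.adj hp, by simp only [Prod.fst_swap] at hc; tauto⟩
  | refl p => exact Iff.rfl
  | symm p q h ih =>
    refine (ih ?_).symm
    rw [hH.eq_of_mem hp]
    exact Relation.EqvGen.symm _ _ h
  | trans p q r h _ ih₁ ih₂ =>
    refine (ih₁ hp).trans (ih₂ ?_)
    rw [hH.eq_of_mem hp]
    exact h

theorem carrier_subset_or (hZ : IsMedian Z) (hH : IsHyperplane Z H)
    (hK : IsHyperplane Z K) (hT : IsHalfspace Z K T) (hne : H ≠ K) (hn : ¬ Transverse Z H K) :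
    carrier H ⊆ T ∨ carrier H ⊆ Tᶜ := by
  obtain ⟨x, y, hxy⟩ := hH.nonempty
  have key : ∀ z ∈ carrier H, x ∈ T ↔ z ∈ T := by
    rintro z ⟨w, hw⟩
    refine mem_iff_of_not_transverse hZ hH hK hT hne hn hxy (q := (z, w)) ?_
    rwa [hH.eq_of_mem hxy] at hw
  by_cases hx : x ∈ T
  · exact Or.inl fun z hz => (key z hz).1 hx
  · exact Or.inr fun z hz h => hx ((key z hz).2 h)

theorem Transverse.symm (h : Transverse Z H K) : Transverse Z K H := by
  obtain ⟨a, b, c, d, h, h1, h2⟩ := h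
  exact ⟨a, c, b, d, h.transpose, h2, h1⟩

theorem Transverse.ne (hZ : IsMedian Z) (h : Transverse Z H K) (hH : IsHyperplane Z H) :
    H ≠ K := by
  rintro rfl
  obtain ⟨a, b, c, d, h, h1, h2⟩ := h
  exact h.2.2.2.2.2 (hZ.edge_unique hH h1 h2)

theorem Transverse.inter_nonempty (hZ : IsMedian Z) (h : Transverse Z H K)
    (hH : IsHyperplane Z H) (hK : IsHyperplane Z K) (hS : IsHalfspace Z H S)
    (hT : IsHalfspace Z K T) : (S ∩ T).Nonempty := by
  have hne := h.ne hZ hH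
  obtain ⟨a, b, c, d, h, h1, h2⟩ := h
  have h3 : (c, d) ∈ H := hH.mem_of_opposite h1 h
  have h4 : (b, d) ∈ K := hK.mem_of_opposite h2 h.transpose
  have n1 : (a, b) ∉ K := fun h' => hne (hH.eq_of_mem_of_mem hK h1 h')
  have n2 : (a, c) ∉ H := fun h' => hne (hH.eq_of_mem_of_mem hK h' h2)
  have n3 : (c, d) ∉ K := fun h' => hne (hH.eq_of_mem_of_mem hK h3 h')
  have n4 : (b, d) ∉ H := fun h' => hne (hH.eq_of_mem_of_mem hK h' h4)
  have hac := hZ.mem_iff_of_notMem hH hS h.2.2.1 n2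
  have hbd := hZ.mem_iff_of_notMem hH hS h.2.2.2.1 n4
  have hab := hZ.mem_iff_of_notMem hK hT h.1 n1
  have hcd := hZ.mem_iff_of_notMem hK hT h.2.1 n3
  have e1 := ((hZ.mem_hyperplane_iff hH hS).1 h1).2
  have e2 := ((hZ.mem_hyperplane_iff hK hT).1 h2).2
  simp only at hac hbd hab hcd
  by_cases ha : a ∈ S <;> by_cases ha' : a ∈ T
  · exact ⟨a, ha, ha'⟩
  · exact ⟨c, hac.1 ha, not_not.1 (mt e2.2 ha')⟩
  · exact ⟨b, not_not.1 (mt e1.2 ha), hab.1 ha'⟩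
  · exact ⟨d, hbd.1 (not_not.1 (mt e1.2 ha)), hcd.1 (not_not.1 (mt e2.2 ha'))⟩

/-- Without transversality, the carrier of `H` would lie on one side of `K`. On the other side there
are points on both sides of `H`, and a geodesic joining them stays there by convexity while crossing
`H`. -/
theorem transverse_of_inter_nonempty (hZ : IsMedian Z)
    (hH : IsHyperplane Z H) (hK : IsHyperplane Z K) (hS : IsHalfspace Z H S)
    (hT : IsHalfspace Z K T) (h1 : (S ∩ T).Nonempty) (h2 : (S ∩ Tᶜ).Nonempty)
    (h3 : (Sᶜ ∩ T).Nonempty) (h4 : (Sᶜ ∩ Tᶜ).Nonempty) : Transverse Z H K := by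
  have hS' := hZ.isHalfspace_compl hH hS
  have hT' := hZ.isHalfspace_compl hK hT
  have hne : H ≠ K := by
    rintro rfl
    rcases hZ.eq_or_eq_compl hH hS hT with rfl | rfl
    · simp at h2
    · simp at h1
  by_contra hn
  obtain ⟨x1, hx1, hx1'⟩ := h1
  obtain ⟨x2, hx2, hx2'⟩ := h2
  obtain ⟨x3, hx3, hx3'⟩ := h3
  obtain ⟨x4, hx4, hx4'⟩ := h4
  rcases carrier_subset_or hZ hH hK hT hne hn with h | h
  · obtain ⟨c, d, hcd, -, -, h', -⟩ := hZ.exists_crossing_mem hH hS hK hT' hx2 hx4 hx2' hx4'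
    exact h' (h ⟨d, hcd⟩)
  · obtain ⟨c, d, hcd, -, -, h', -⟩ := hZ.exists_crossing_mem hH hS hK hT hx1 hx3 hx1' hx3'
    exact h ⟨d, hcd⟩ h'

theorem Transverse.smul {G : Type v} [Group G] [MulAction G V] (hG : IsIsometric G Z) (g : G)
    (h : Transverse Z H K) : Transverse Z (g • H) (g • K) := by
  obtain ⟨a, b, c, d, ⟨h1, h2, h3, h4, h5, h6⟩, h7, h8⟩ := h
  exact ⟨g • a, g • b, g • c, g • d,
    ⟨(hG g _ _).2 h1, (hG g _ _).2 h2, (hG g _ _).2 h3, (hG g _ _).2 h4,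
      fun h => h5 (MulAction.injective g h), fun h => h6 (MulAction.injective g h)⟩,
    Set.smul_mem_smul_set h7, Set.smul_mem_smul_set h8⟩

theorem IsMedian.exists_separating (hZ : IsMedian Z) {x y : V} (h : x ≠ y) :
    ∃ H S, IsHyperplane Z H ∧ IsHalfspace Z H S ∧ x ∈ S ∧ y ∉ S := by
  obtain ⟨n, hn⟩ := Nat.exists_eq_succ_of_ne_zero (fun h' => h (hZ.1.dist_eq_zero_iff.1 h'))
  obtain ⟨z, hxz, hz⟩ := exists_adj_dist_eq hZ.1 hn
  refine ⟨_, _, IsHyperplane.of_adj hxz, hZ.isHalfspace_nearer hxz, left_mem_nearer hxz, ?_⟩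
  simp only [nearer, Set.mem_ofPred_eq]
  rw [Z.dist_comm, hn, Z.dist_comm, hz]
  omega

/-- Each edge of a geodesic from `x` to `y` contributes at most one halfspace. -/
theorem IsMedian.finite_separating (hZ : IsMedian Z) (x y : V) :
    {S | (∃ H, IsHyperplane Z H ∧ IsHalfspace Z H S) ∧ x ∈ S ∧ y ∉ S}.Finite := by
  obtain ⟨n, hn⟩ : ∃ n, Z.dist x y = n := ⟨_, rfl⟩
  induction n generalizing x with
  | zero =>
    obtain rfl := hZ.1.dist_eq_zero_iff.1 hn
    refine Set.Finite.subset Set.finite_empty ?_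
    rintro S ⟨-, h1, h2⟩
    exact h2 h1
  | succ n ih =>
    obtain ⟨z, hxz, hz⟩ := exists_adj_dist_eq hZ.1 hn
    refine ((ih z hz).union (Set.finite_singleton (nearer Z x z))).subset ?_
    rintro S ⟨⟨H, hH, hS⟩, h1, h2⟩
    by_cases h : z ∈ S
    · exact Or.inl ⟨⟨H, hH, hS⟩, h, h2⟩
    · exact Or.inr (hZ.eq_nearer hH hS ((hZ.mem_hyperplane_iff hH hS).2 ⟨hxz, by tauto⟩) h1)

end Halfspaces

/-! ## Edge labels of Salvetti-like actions -/

theorem FaceMap.edge_dir {n : ℕ} (x : Fin n → Bool) (i : Fin n) (k : Fin 1) :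
    (FaceMap.edge x i).dir k = i := rfl

theorem FaceMap.edge_base {n : ℕ} (x : Fin n → Bool) (i : Fin n) :
    (FaceMap.edge x i).base = x := rfl

theorem FaceMap.app_edge {n : ℕ} (x : Fin n → Bool) (i : Fin n) (y : Fin 1 → Bool) (j : Fin n) :
    (FaceMap.edge x i).app y j = xor (x j) (if j = i then y 0 else false) := by
  by_cases h : j = i
  · subst h
    rw [if_pos rfl]
    exact FaceMap.app_dir (FaceMap.edge x j) y 0
  · rw [FaceMap.app_of_not]
    · simp [h, FaceMap.edge_base]
    · rintro ⟨k, hk⟩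
      exact h hk.symm

theorem salvetti_face_apply {W : Type*} (Γ : SimpleGraph W) {m n : ℕ} (f : FaceMap m n)
    (c : (salvetti Γ).Cell n) (i : Fin m) : ((salvetti Γ).face f c).1 i =
      ((c.1 (f.dir i)).1, xor (c.1 (f.dir i)).2 (f.base (f.dir i))) := rfl

section Label

variable {V : Type u} {Z : SimpleGraph V}

/-- The vertices of the edge from `a` to `b`. -/
def edgeMap (a b : V) (x : Fin 1 → Bool) : V := if x 0 then b else a

theorem isCube_edgeMap {a b : V} (h : Z.Adj a b) : IsCube Z (edgeMap a b) := by
  intro x y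
  have h1 := SimpleGraph.dist_eq_one_iff_adj.2 h
  have h2 := SimpleGraph.dist_eq_one_iff_adj.2 h.symm
  rcases hx : x 0 <;> rcases hy : y 0 <;>
    simp [edgeMap, hammingDist, hx, hy, h1, h2, Finset.filter_singleton]

/-- The vertices of the square with corners `a`, `b`, `c`, `d`, where `a` and `d` are opposite. -/
def squareMap (a b c d : V) (x : Fin 2 → Bool) : V :=
  if x 0 then (if x 1 then d else b) else (if x 1 then c else a)

theorem IsMedian.dist_eq_two (hZ : IsMedian Z) {a b d : V} (hab : Z.Adj a b) (hbd : Z.Adj b d)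
    (had : a ≠ d) : Z.dist a d = 2 := by
  have e1 := hZ.dist_adj hbd a
  have e2 := SimpleGraph.dist_eq_one_iff_adj.2 hab
  have e3 : Z.dist a d ≠ 0 := fun h => had (hZ.1.dist_eq_zero_iff.1 h)
  omega

theorem IsMedian.isCube_squareMap (hZ : IsMedian Z) {a b c d : V}
    (h : Opposite Z (a, b) (c, d)) : IsCube Z (squareMap a b c d) := by
  obtain ⟨hab, hcd, hac, hbd, had, hbc⟩ := h
  simp only at hab hcd hac hbd had hbc
  have h1 := SimpleGraph.dist_eq_one_iff_adj.2 hab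
  have h2 := SimpleGraph.dist_eq_one_iff_adj.2 hab.symm
  have h3 := SimpleGraph.dist_eq_one_iff_adj.2 hcd
  have h4 := SimpleGraph.dist_eq_one_iff_adj.2 hcd.symm
  have h5 := SimpleGraph.dist_eq_one_iff_adj.2 hac
  have h6 := SimpleGraph.dist_eq_one_iff_adj.2 hac.symm
  have h7 := SimpleGraph.dist_eq_one_iff_adj.2 hbd
  have h8 := SimpleGraph.dist_eq_one_iff_adj.2 hbd.symm
  have h9 := hZ.dist_eq_two hab hbd had
  have h10 := hZ.dist_eq_two hbd.symm hab.symm had.symm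
  have h11 := hZ.dist_eq_two hab.symm hac hbc
  have h12 := hZ.dist_eq_two hac.symm hab hbc.symm
  intro x y
  have key : hammingDist x y = (if x 0 = y 0 then 0 else 1) + (if x 1 = y 1 then 0 else 1) := by
    simp only [hammingDist, Finset.card_filter, Fin.sum_univ_two, ne_eq, ite_not]
  rw [key]
  rcases hx : x 0 <;> rcases hy : y 0 <;> rcases hx' : x 1 <;> rcases hy' : y 1 <;>
    simp [squareMap, *]

variable {G : Type v} [Group G] [MulAction G V]

/-- The image of a cube of `Z` in the quotient. -/
def cell (G : Type v) [Group G] [MulAction G V] {n : ℕ} {c : (Fin n → Bool) → V}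
    (hc : IsCube Z c) : (quotient G Z).Cell n := Quot.mk _ ⟨c, hc⟩

/-- Lying in the same orbit is already an equivalence relation, so the quotient identifies nothing
more. -/
theorem cell_eq_iff {n : ℕ} {c c' : (Fin n → Bool) → V} (hc : IsCube Z c) (hc' : IsCube Z c') :
    cell G hc = cell G hc' ↔ ∃ g : G, ∀ x, g • c x = c' x := by
  refine Equivalence.quot_mk_eq_iff ⟨?_, ?_, ?_⟩ _ _
  · exact fun c => ⟨1, fun x => one_smul _ _⟩
  · rintro c c' ⟨g, h⟩
    exact ⟨g⁻¹, fun x => by rw [← h, inv_smul_smul]⟩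
  · rintro c c' c'' ⟨g, h⟩ ⟨g', h'⟩
    exact ⟨g' * g, fun x => by rw [mul_smul, h, h']⟩

theorem exists_cell_eq {n : ℕ} (q : (quotient G Z).Cell n) :
    ∃ (c : (Fin n → Bool) → V) (hc : IsCube Z c), cell G hc = q := by
  obtain ⟨⟨c, hc⟩, h⟩ := Quot.exists_rep q
  exact ⟨c, hc, h⟩

theorem IsCube.comp_face {m n : ℕ} {c : (Fin n → Bool) → V} (hc : IsCube Z c) (f : FaceMap m n) :
    IsCube Z fun x => c (f.app x) := fun x y => by rw [hc, FaceMap.hammingDist_app]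

theorem face_cell {m n : ℕ} {c : (Fin n → Bool) → V} (hc : IsCube Z c) (f : FaceMap m n) :
    (quotient G Z).face f (cell G hc) = cell G (hc.comp_face f) := rfl

theorem cell_congr {n : ℕ} {c c' : (Fin n → Bool) → V} (hc : IsCube Z c) (hc' : IsCube Z c')
    (h : ∀ x, c x = c' x) : cell G hc = cell G hc' := by
  obtain rfl : c = c' := funext h
  rfl

/-- The image of an edge of `Z` in the quotient. -/
def edgeCell (G : Type v) [Group G] [MulAction G V] {a b : V} (h : Z.Adj a b) :
    (quotient G Z).Cell 1 := cell G (isCube_edgeMap h)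

theorem edgeCell_eq_iff {a b a' b' : V} (h : Z.Adj a b) (h' : Z.Adj a' b') :
    edgeCell G h = edgeCell G h' ↔ ∃ g : G, g • a = a' ∧ g • b = b' := by
  rw [edgeCell, edgeCell, cell_eq_iff]
  constructor
  · rintro ⟨g, hg⟩
    exact ⟨g, by simpa [edgeMap] using hg fun _ => false, by simpa [edgeMap] using hg fun _ => true⟩
  · rintro ⟨g, h1, h2⟩
    refine ⟨g, fun x => ?_⟩
    rcases hx : x 0 <;> simp [edgeMap, hx, h1, h2]

theorem edgeCell_face {n : ℕ} {c : (Fin n → Bool) → V} (hc : IsCube Z c) (f : FaceMap 1 n)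
    {a b : V} (h : Z.Adj a b) (ha : c (f.app fun _ => false) = a)
    (hb : c (f.app fun _ => true) = b) :
    edgeCell G h = (quotient G Z).face f (cell G hc) := by
  rw [face_cell]
  refine cell_congr _ _ fun x => ?_
  have hx : x = fun _ => x 0 := by
    funext i
    rw [Subsingleton.elim i 0]
  rw [hx]
  rcases x 0
  · simp [edgeMap, ha]
  · simp [edgeMap, hb]

theorem edgeCell_swap {a b : V} (h : Z.Adj a b) :
    edgeCell G h.symm = (quotient G Z).face FaceMap.rev (edgeCell G h) := by
  refine edgeCell_face (isCube_edgeMap h) _ _ ?_ ?_ <;>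
    simp [edgeMap, FaceMap.rev, FaceMap.app_edge]

theorem Opposite.edgeCell_left (hZ : IsMedian Z) {a b c d : V} (h : Opposite Z (a, b) (c, d))
    (hab : Z.Adj a b) : edgeCell G hab = (quotient G Z).face (FaceMap.edge ![false, false] 0)
      (cell G (hZ.isCube_squareMap h)) := by
  refine edgeCell_face _ _ _ ?_ ?_ <;> simp [squareMap, FaceMap.app_edge]

theorem Opposite.edgeCell_right (hZ : IsMedian Z) {a b c d : V} (h : Opposite Z (a, b) (c, d))
    (hcd : Z.Adj c d) : edgeCell G hcd = (quotient G Z).face (FaceMap.edge ![false, true] 0)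
      (cell G (hZ.isCube_squareMap h)) := by
  refine edgeCell_face _ _ _ ?_ ?_ <;> simp [squareMap, FaceMap.app_edge]

theorem Opposite.edgeCell_side (hZ : IsMedian Z) {a b c d : V} (h : Opposite Z (a, b) (c, d))
    (hac : Z.Adj a c) : edgeCell G hac = (quotient G Z).face (FaceMap.edge ![false, false] 1)
      (cell G (hZ.isCube_squareMap h)) := by
  refine edgeCell_face _ _ _ ?_ ?_ <;> simp [squareMap, FaceMap.app_edge]

theorem isCube_const (x : V) : IsCube Z (fun _ : Fin 0 → Bool => x) := by
  intro y z
  simp [hammingDist]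

theorem exists_square_eq (hZ : IsMedian Z) (q : (quotient G Z).Cell 2) :
    ∃ a b c d, ∃ h : Opposite Z (a, b) (c, d), cell G (hZ.isCube_squareMap h) = q := by
  obtain ⟨c, hc, rfl⟩ := exists_cell_eq q
  have hadj : ∀ u v, hammingDist u v = 1 → Z.Adj (c u) (c v) := fun u v h =>
    SimpleGraph.dist_eq_one_iff_adj.1 (by rw [hc, h])
  have hne : ∀ u v, hammingDist u v = 2 → c u ≠ c v := by
    intro u v h h'
    have := hc u v
    rw [h', SimpleGraph.dist_self, h] at this
    exact absurd this (by decide)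
  refine ⟨c ![false, false], c ![true, false], c ![false, true], c ![true, true],
    ⟨hadj _ _ (by decide), hadj _ _ (by decide), hadj _ _ (by decide), hadj _ _ (by decide),
      hne _ _ (by decide), hne _ _ (by decide)⟩, cell_congr _ _ fun x => ?_⟩
  have hx : x = ![x 0, x 1] := by
    funext i
    fin_cases i <;> rfl
  rw [hx]
  rcases x 0 <;> rcases x 1 <;> simp [squareMap]

/-- The image of a vertex of `Z` in the quotient. -/
def vertexCell (G : Type v) [Group G] [MulAction G V] (Z : SimpleGraph V) (x : V) :
    (quotient G Z).Cell 0 := cell G (isCube_const (Z := Z) x)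

theorem vertexCell_eq_iff {x y : V} :
    vertexCell G Z x = vertexCell G Z y ↔ ∃ g : G, g • x = y := by
  rw [vertexCell, vertexCell, cell_eq_iff]
  exact exists_congr fun g => ⟨fun h => h Fin.elim0, fun h _ => h⟩

theorem exists_vertexCell_eq (q : (quotient G Z).Cell 0) : ∃ x, vertexCell G Z x = q := by
  obtain ⟨c, hc, rfl⟩ := exists_cell_eq q
  exact ⟨c Fin.elim0, cell_congr _ _ fun x => by rw [Subsingleton.elim x Fin.elim0]⟩

theorem vertexCell_left {a b : V} (h : Z.Adj a b) : vertexCell G Z a =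
    (quotient G Z).face (FaceMap.vertex fun _ => false) (edgeCell G h) := by
  refine cell_congr _ _ fun x => ?_
  have : (FaceMap.vertex fun _ : Fin 1 => false).app x = fun _ => false := by
    funext j
    exact FaceMap.app_of_not _ _ _ fun ⟨i, _⟩ => i.elim0
  simp [this, edgeMap]

theorem exists_edgeCell_eq (q : (quotient G Z).Cell 1) :
    ∃ a b, ∃ h : Z.Adj a b, edgeCell G h = q := by
  obtain ⟨c, hc, rfl⟩ := exists_cell_eq q
  refine ⟨c fun _ => false, c fun _ => true, SimpleGraph.dist_eq_one_iff_adj.1 ?_,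
    cell_congr _ _ fun x => ?_⟩
  · rw [hc]
    decide
  · have hx : x = fun _ => x 0 := by
      funext i
      rw [Subsingleton.elim i 0]
    rw [hx]
    rcases x 0 <;> simp [edgeMap]

variable {W : Type*} {Γ : SimpleGraph W} (Φ : CubicalSet.Iso (quotient G Z) (salvetti Γ))

/-- The generator and the orientation associated with an oriented edge, by an isomorphism of the
quotient with a Salvetti complex. -/
def label {a b : V} (h : Z.Adj a b) : W × Bool := (Φ.equiv 1 (edgeCell G h)).1 0

theorem label_congr {a b a' b' : V} (h : Z.Adj a b) (h' : Z.Adj a' b') (ha : a = a')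
    (hb : b = b') : label Φ h = label Φ h' := by
  subst ha hb
  rfl

/-- An edge of the Salvetti complex is its label, and cells are parametrized, so equal labels mean
equal orbits of oriented edges. -/
theorem label_eq_iff {a b a' b' : V} (h : Z.Adj a b) (h' : Z.Adj a' b') :
    label Φ h = label Φ h' ↔ ∃ g : G, g • a = a' ∧ g • b = b' := by
  rw [← edgeCell_eq_iff h h', ← (Φ.equiv 1).injective.eq_iff]
  constructor
  · intro he
    refine Subtype.ext (funext fun i => ?_)
    rw [Subsingleton.elim i 0]
    exact he
  · intro he
    rw [label, he, label]

theorem label_smul (g : G) {a b : V} (h : Z.Adj a b) (h' : Z.Adj (g • a) (g • b)) :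
    label Φ h' = label Φ h :=
  ((label_eq_iff Φ h h').2 ⟨g, rfl, rfl⟩).symm

theorem label_swap {a b : V} (h : Z.Adj a b) :
    label Φ h.symm = ((label Φ h).1, !(label Φ h).2) := by
  rw [label, edgeCell_swap h, Φ.map_face]
  simp [label, salvetti_face_apply, FaceMap.rev, FaceMap.edge_dir, FaceMap.edge_base]

theorem Opposite.label_eq (hZ : IsMedian Z) {a b c d : V} (h : Opposite Z (a, b) (c, d))
    (hab : Z.Adj a b) (hcd : Z.Adj c d) : label Φ hab = label Φ hcd := by
  rw [label, label, h.edgeCell_left hZ, h.edgeCell_right hZ, Φ.map_face, Φ.map_face]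
  simp [salvetti_face_apply, FaceMap.edge_dir, FaceMap.edge_base]

theorem Opposite.adj_label (hZ : IsMedian Z) {a b c d : V} (h : Opposite Z (a, b) (c, d))
    (hab : Z.Adj a b) (hac : Z.Adj a c) : Γ.Adj (label Φ hab).1 (label Φ hac).1 := by
  rw [label, label, h.edgeCell_left hZ, h.edgeCell_side hZ, Φ.map_face, Φ.map_face]
  exact (Φ.equiv 2 (cell G (hZ.isCube_squareMap h))).2 0 1 (by simp)

-- A vertex of the Salvetti complex is a function on `Fin 0`, hence unique.
include Φ in
theorem exists_smul_eq_of_iso (x y : V) : ∃ g : G, g • x = y := by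
  exact vertexCell_eq_iff.1 ((Φ.equiv 0).injective (Subtype.ext (funext fun i => i.elim0)))

theorem IsFree.eq_one_of_smul_eq (hf : IsFree G Z) {g : G} {x : V} (h : g • x = x) : g = 1 := by
  refine hf g 0 (fun _ => x) (isCube_const x) ?_
  rw [Set.range_const, Set.smul_set_singleton, h]

theorem eq_of_label_eq (hf : IsFree G Z) {x y z : V} (hy : Z.Adj x y) (hz : Z.Adj x z)
    (h : label Φ hy = label Φ hz) : y = z := by
  obtain ⟨g, h1, h2⟩ := (label_eq_iff Φ _ _).1 h
  rw [hf.eq_one_of_smul_eq h1, one_smul] at h2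
  exact h2

/-- The two labels form an ordered clique, that is a square of the Salvetti complex. A lift of it
can be translated to `x` by transitivity, and its two sides at `x` are then the given edges because
labels determine edges at a vertex. -/
theorem exists_opposite_of_adj_label (hZ : IsMedian Z) (hG : IsIsometric G Z) (hf : IsFree G Z)
    {x y z : V} (hy : Z.Adj x y) (hz : Z.Adj x z)
    (h : Γ.Adj (label Φ hy).1 (label Φ hz).1) : ∃ w, Opposite Z (x, y) (z, w) := by
  let s : (salvetti Γ).Cell 2 := ⟨![label Φ hy, label Φ hz], by
    intro i j hij
    fin_cases i <;> fin_cases j <;> simp_all [h.symm]⟩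
  obtain ⟨a, b, c, d, hop, hs⟩ := exists_square_eq hZ ((Φ.equiv 2).symm s)
  have hΦ : Φ.equiv 2 (cell G (hZ.isCube_squareMap hop)) = s := by rw [hs, Equiv.apply_symm_apply]
  obtain ⟨g, rfl⟩ := exists_smul_eq_of_iso Φ a x
  have f1 := (hG g _ _).2 hop.1
  have f2 := (hG g _ _).2 hop.2.2.1
  have l1 : label Φ f1 = label Φ hy := by
    rw [label_smul Φ g hop.1, label, hop.edgeCell_left hZ, Φ.map_face, hΦ, salvetti_face_apply]
    simp [FaceMap.edge_dir, FaceMap.edge_base, s]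
  have l2 : label Φ f2 = label Φ hz := by
    rw [label_smul Φ g hop.2.2.1, label, hop.edgeCell_side hZ, Φ.map_face, hΦ, salvetti_face_apply]
    simp [FaceMap.edge_dir, FaceMap.edge_base, s]
  obtain rfl := eq_of_label_eq Φ hf _ _ l1
  obtain rfl := eq_of_label_eq Φ hf _ _ l2
  exact ⟨g • d, hy, (hG g _ _).2 hop.2.1, hz, (hG g _ _).2 hop.2.2.2.1,
    fun h => hop.2.2.2.2.1 (MulAction.injective g h),
    fun h => hop.2.2.2.2.2 (MulAction.injective g h)⟩

end Label

/-! ## The collapse map -/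

section DualVertex

variable {E : Type u} {𝓢 : Set (Set E)}

/-- A neighbour of `σ` is determined by the wall that is flipped. -/
theorem DualVertex.eq_of_sdiff {σ τ τ' : DualVertex 𝓢} {h : Set E}
    (h1 : σ.parts \ τ.parts = {h}) (h2 : τ.parts \ σ.parts = {hᶜ})
    (h1' : σ.parts \ τ'.parts = {h}) (h2' : τ'.parts \ σ.parts = {hᶜ}) : τ = τ' := by
  refine DualVertex.ext (Set.ext fun k => ?_)
  have e1 := Set.ext_iff.1 h1 k
  have e2 := Set.ext_iff.1 h2 k
  have e3 := Set.ext_iff.1 h1' k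
  have e4 := Set.ext_iff.1 h2' k
  simp only [Set.mem_sdiff, Set.mem_singleton_iff] at e1 e2 e3 e4
  tauto

end DualVertex

section CollapseMap

variable {V : Type u} {Z : SimpleGraph V}

/-- The restriction quotient. -/
def collapseMap (hZ : IsMedian Z) (𝓗 : Set (Set (V × V))) (x : V) :
    DualVertex (remainingHalfspaces Z 𝓗) where
  parts := {S ∈ remainingHalfspaces Z 𝓗 | x ∈ S}
  subset := fun S hS => hS.1
  choice := by
    rintro S ⟨H, hH, hn, hS⟩
    have h1 : S ∈ remainingHalfspaces Z 𝓗 := ⟨H, hH, hn, hS⟩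
    have h2 : Sᶜ ∈ remainingHalfspaces Z 𝓗 := ⟨H, hH, hn, hZ.isHalfspace_compl hH hS⟩
    by_cases hx : x ∈ S
    · exact Or.inl ⟨⟨h1, hx⟩, fun h => h.2 hx⟩
    · exact Or.inr ⟨⟨h2, hx⟩, fun h => hx h.2⟩
  inter := fun S hS T hT => ⟨x, hS.2, hT.2⟩
  finite := by
    intro y
    refine (hZ.finite_separating x y).subset ?_
    rintro S ⟨⟨⟨H, hH, -, hS⟩, hx⟩, hy⟩
    exact ⟨⟨H, hH, hS⟩, hx, hy⟩

/-- The properties of the restriction quotient `π : Z → Z'` associated with the hyperplanes that do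
not belong to `𝓗`. -/
structure IsCollapseMap {V' : Type*} (G : Type v) [Group G] [MulAction G V] [MulAction G V']
    (Z : SimpleGraph V) (Z' : SimpleGraph V') (𝓗 : Set (Set (V × V))) (π : V → V') : Prop where
  smul : ∀ (g : G) (x : V), π (g • x) = g • π x
  adj : ∀ H, IsHyperplane Z H → H ∉ 𝓗 → ∀ x y, (x, y) ∈ H → Z'.Adj (π x) (π y)
  eq_of_mem : ∀ H, IsHyperplane Z H → H ∈ 𝓗 → ∀ x y, (x, y) ∈ H → π x = π y
  mem_iff : ∀ H, IsHyperplane Z H → H ∉ 𝓗 → ∀ S, IsHalfspace Z H S → ∀ x y, π x = π y →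
    (x ∈ S ↔ y ∈ S)
  hyperplane_eq : ∀ H K, IsHyperplane Z H → IsHyperplane Z K → H ∉ 𝓗 → K ∉ 𝓗 →
    ∀ x y x' y', (x, y) ∈ H → (x', y') ∈ K → π x = π x' → π y = π y' → H = K
  transverse : ∀ H K, IsHyperplane Z H → IsHyperplane Z K → H ∉ 𝓗 → K ∉ 𝓗 →
    ∀ x y z w, (x, y) ∈ H → (x, z) ∈ K → Opposite Z' (π x, π y) (π z, w) → Transverse Z H K

variable {𝓗 : Set (Set (V × V))} {H K : Set (V × V)} {S : Set V}

/-- The ends of an edge are separated by its dual hyperplane only, so exactly one chosen halfspace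
changes. -/
theorem collapseMap_sdiff (hZ : IsMedian Z) (hH : IsHyperplane Z H) (hn : H ∉ 𝓗)
    (hS : IsHalfspace Z H S) {x y : V} (h : (x, y) ∈ H) (hx : x ∈ S) :
    (collapseMap hZ 𝓗 x).parts \ (collapseMap hZ 𝓗 y).parts = {S} := by
  ext T
  constructor
  · rintro ⟨⟨⟨K, hK, hKn, hT⟩, hxT⟩, h2⟩
    have hy : y ∉ T := fun hy => h2 ⟨⟨K, hK, hKn, hT⟩, hy⟩
    have hK' : (x, y) ∈ K := (hZ.mem_hyperplane_iff hK hT).2 ⟨hH.adj h, by tauto⟩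
    exact (hZ.eq_nearer hK hT hK' hxT).trans (hZ.eq_nearer hH hS h hx).symm
  · rintro rfl
    refine ⟨⟨⟨H, hH, hn, hS⟩, hx⟩, fun h' => ?_⟩
    exact (((hZ.mem_hyperplane_iff hH hS).1 h).2.1 hx) h'.2

theorem collapseMap_sdiff_compl (hZ : IsMedian Z) (hH : IsHyperplane Z H) (hn : H ∉ 𝓗)
    (hS : IsHalfspace Z H S) {x y : V} (h : (x, y) ∈ H) (hx : x ∈ S) :
    (collapseMap hZ 𝓗 y).parts \ (collapseMap hZ 𝓗 x).parts = {Sᶜ} :=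
  collapseMap_sdiff hZ hH hn (hZ.isHalfspace_compl hH hS) (hH.swap_mem h)
    (((hZ.mem_hyperplane_iff hH hS).1 h).2.1 hx)

theorem IsMedian.exists_halfspace (hZ : IsMedian Z) (hH : IsHyperplane Z H) {x y : V}
    (h : (x, y) ∈ H) : ∃ S, IsHalfspace Z H S ∧ x ∈ S ∧ y ∉ S := by
  have hS : IsHalfspace Z H {z | SameSide Z H x z} := ⟨x, rfl⟩
  have hx : x ∈ {z | SameSide Z H x z} := Relation.ReflTransGen.refl
  exact ⟨_, hS, hx, ((hZ.mem_hyperplane_iff hH hS).1 h).2.1 hx⟩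

theorem isCollapseMap_collapseMap {G : Type v} [Group G] [MulAction G V] (hZ : IsMedian Z)
    (hG : IsIsometric G Z) (h𝓗 : IsInvariantFamily G Z 𝓗) :
    letI := collapseAction hG h𝓗
    IsCollapseMap G Z (collapse Z 𝓗) 𝓗 (collapseMap hZ 𝓗) := by
  let := collapseAction hG h𝓗
  refine ⟨?_, ?_, ?_, ?_, ?_, ?_⟩
  · intro g x
    refine DualVertex.ext (Set.ext fun S => ?_)
    have e : (g • collapseMap hZ 𝓗 x).parts = g • (collapseMap hZ 𝓗 x).parts := rfl
    rw [e, Set.mem_smul_set_iff_inv_smul_mem]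
    constructor
    · rintro ⟨h1, h2⟩
      refine ⟨remainingHalfspaces_smul hG h𝓗 g⁻¹ S h1, ?_⟩
      rw [Set.mem_smul_set_iff_inv_smul_mem, inv_inv]
      exact h2
    · rintro ⟨h1, h2⟩
      refine ⟨?_, ?_⟩
      · have := remainingHalfspaces_smul hG h𝓗 g _ h1
        rwa [smul_inv_smul] at this
      · rwa [Set.mem_smul_set_iff_inv_smul_mem, inv_inv] at h2
  · intro H hH hn x y h
    obtain ⟨S, hS, hx, hy⟩ := hZ.exists_halfspace hH h
    exact ⟨S, collapseMap_sdiff hZ hH hn hS h hx, collapseMap_sdiff_compl hZ hH hn hS h hx⟩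
  · intro H hH hm x y h
    refine DualVertex.ext (Set.ext fun S => ?_)
    refine and_congr_right ?_
    rintro ⟨K, hK, hn, hS⟩
    refine hZ.mem_iff_of_notMem hK hS (hH.adj h) fun h' => hn ?_
    rwa [← hH.eq_of_mem_of_mem hK h h']
  · intro H hH hn S hS x y h
    have := Set.ext_iff.1 (congrArg DualVertex.parts h) S
    have hm : S ∈ remainingHalfspaces Z 𝓗 := ⟨H, hH, hn, hS⟩
    exact ⟨fun hx => (this.1 ⟨hm, hx⟩).2, fun hy => (this.2 ⟨hm, hy⟩).2⟩
  · intro H K hH hK hn hn' x y x' y' h h' hx hy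
    obtain ⟨S, hS, hxS, -⟩ := hZ.exists_halfspace hH h
    obtain ⟨T, hT, hxT, -⟩ := hZ.exists_halfspace hK h'
    have e1 := collapseMap_sdiff hZ hH hn hS h hxS
    have e2 := collapseMap_sdiff hZ hK hn' hT h' hxT
    rw [hx, hy, e2] at e1
    obtain rfl := Set.singleton_injective e1
    exact hZ.hyperplane_eq_of_halfspace hH hK hS hT
  · rintro H K hH hK hn hn' x y z w h h' ⟨-, ⟨k, hk1, hk2⟩, -, ⟨k', hk1', hk2'⟩, had, hbc⟩
    simp only at hk1 hk2 hk1' hk2' had hbc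
    obtain ⟨S, hS, hxS, hyS⟩ := hZ.exists_halfspace hH h
    obtain ⟨T, hT, hxT, hzT⟩ := hZ.exists_halfspace hK h'
    have a1 := collapseMap_sdiff hZ hH hn hS h hxS
    have a2 := collapseMap_sdiff_compl hZ hH hn hS h hxS
    have b1 := collapseMap_sdiff hZ hK hn' hT h' hxT
    have b2 := collapseMap_sdiff_compl hZ hK hn' hT h' hxT
    have hSm : S ∈ remainingHalfspaces Z 𝓗 := ⟨H, hH, hn, hS⟩
    have hTm : T ∈ remainingHalfspaces Z 𝓗 := ⟨K, hK, hn', hT⟩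
    have hSm' : Sᶜ ∈ remainingHalfspaces Z 𝓗 := ⟨H, hH, hn, hZ.isHalfspace_compl hH hS⟩
    have hTm' : Tᶜ ∈ remainingHalfspaces Z 𝓗 := ⟨K, hK, hn', hZ.isHalfspace_compl hK hT⟩
    have hST : S ≠ T := by
      rintro rfl
      exact hbc (DualVertex.eq_of_sdiff a1 a2 b1 b2)
    have hyT : y ∈ T := by
      by_contra hy
      have : T ∈ (collapseMap hZ 𝓗 x).parts \ (collapseMap hZ 𝓗 y).parts :=
        ⟨⟨hTm, hxT⟩, fun h => hy h.2⟩
      rw [a1] at this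
      exact hST this.symm
    have hzS : z ∈ S := by
      by_contra hz
      have : S ∈ (collapseMap hZ 𝓗 x).parts \ (collapseMap hZ 𝓗 z).parts :=
        ⟨⟨hSm, hxS⟩, fun h => hz h.2⟩
      rw [b1] at this
      exact hST this
    -- Otherwise the edge from `π y` to `w` flips the wall of `H` back, and `w` would be `π x`.
    have hwS : Sᶜ ∈ w.parts := by
      by_contra hc
      have : Sᶜ ∈ (collapseMap hZ 𝓗 y).parts \ w.parts := ⟨⟨hSm', hyS⟩, hc⟩
      rw [hk1'] at this
      obtain rfl : Sᶜ = k' := this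
      exact had (DualVertex.eq_of_sdiff a2 (by rw [a1, compl_compl]) hk1' hk2')
    have hwT : Tᶜ ∈ w.parts := by
      by_contra hc
      have : Tᶜ ∈ (collapseMap hZ 𝓗 z).parts \ w.parts := ⟨⟨hTm', hzT⟩, hc⟩
      rw [hk1] at this
      obtain rfl : Tᶜ = k := this
      exact had (DualVertex.eq_of_sdiff b2 (by rw [b1, compl_compl]) hk1 hk2)
    -- The corner `w` need not be known to come from a vertex of `Z`: two parts chosen by `w`
    -- intersect, which supplies a point in the fourth quadrant.
    exact transverse_of_inter_nonempty hZ hH hK hS hT ⟨x, hxS, hxT⟩ ⟨z, hzS, hzT⟩ ⟨y, hyS, hyT⟩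
      (w.inter _ hwS _ hwT)

end CollapseMap

/-! ## Cospatial actions are cospecial -/

section Cospecial

variable {V V' : Type*} {G W : Type*} [Group G] [MulAction G V] [MulAction G V']
  {Z : SimpleGraph V} {Z' : SimpleGraph V'} {𝓗 : Set (Set (V × V))} {π : V → V'}
  {Γ : SimpleGraph W} (Φ : CubicalSet.Iso (quotient G Z') (salvetti Γ))
  {H K : Set (V × V)} {S : Set V} {g : G}

/-- A square across which the edge slides is either flattened by `π`, its lateral hyperplane being
collapsed, so both edges have the same image, or sent to a square of `Z'`, nondegenerate because `H`
still separates the images. Either way the label survives; reversal changes its sign and the side of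
the origin simultaneously. -/
theorem IsCollapseMap.label_parallel (hπ : IsCollapseMap G Z Z' 𝓗 π) (hZ : IsMedian Z)
    (hZ' : IsMedian Z') (hH : IsHyperplane Z H) (hn : H ∉ 𝓗) (hS : IsHalfspace Z H S)
    {p q : V × V} (hp : p ∈ H) (hpq : Parallel Z p q) (ep : Z'.Adj (π p.1) (π p.2))
    (eq : Z'.Adj (π q.1) (π q.2)) :
    ((p.1 ∈ S ↔ q.1 ∈ S) ∧ label Φ ep = label Φ eq) ∨
      ((p.1 ∈ S ↔ q.1 ∉ S) ∧ label Φ eq = ((label Φ ep).1, !(label Φ ep).2)) := by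
  induction hpq with
  | rel p q h =>
    rcases h with h | rfl
    · obtain ⟨a, b⟩ := p
      obtain ⟨c, d⟩ := q
      have hq : (c, d) ∈ H := hH.mem_of_opposite hp h
      have hac : (a, c) ∉ H := fun h' => h.2.2.2.2.2 (hZ.edge_unique hH hp h')
      have hacS := hZ.mem_iff_of_notMem hH hS h.2.2.1 hac
      left
      refine ⟨hacS, ?_⟩
      have hK := IsHyperplane.of_adj h.2.2.1
      have m1 : (a, c) ∈ {q | Parallel Z (a, c) q} := Relation.EqvGen.refl _
      have m2 := hK.mem_of_opposite m1 h.transpose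
      by_cases hKn : {q | Parallel Z (a, c) q} ∈ 𝓗
      · exact label_congr Φ _ _ (hπ.eq_of_mem _ hK hKn _ _ m1) (hπ.eq_of_mem _ hK hKn _ _ m2)
      · have s1 := ((hZ.mem_hyperplane_iff hH hS).1 hp).2
        have s2 := ((hZ.mem_hyperplane_iff hH hS).1 hq).2
        refine Opposite.label_eq Φ hZ' (a := π a) (b := π b) (c := π c) (d := π d)
          ⟨ep, eq, hπ.adj _ hK hKn _ _ m1, hπ.adj _ hK hKn _ _ m2, fun h' => ?_, fun h' => ?_⟩ ep eq
        · have := hπ.mem_iff H hH hn S hS _ _ h'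
          simp only at hacS
          tauto
        · have := hπ.mem_iff H hH hn S hS _ _ h'
          simp only at hacS
          tauto
    · right
      exact ⟨((hZ.mem_hyperplane_iff hH hS).1 hp).2, label_swap Φ ep⟩
  | refl p => exact Or.inl ⟨Iff.rfl, rfl⟩
  | symm p q h ih =>
    have hq : p ∈ H := by
      rw [hH.eq_of_mem hp]
      exact Relation.EqvGen.symm _ _ h
    rcases ih hq eq ep with ⟨h1, h2⟩ | ⟨h1, h2⟩
    · exact Or.inl ⟨h1.symm, h2.symm⟩
    · exact Or.inr ⟨by tauto, by simp [h2]⟩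
  | trans p q r h _ ih₁ ih₂ =>
    have hq : q ∈ H := by
      rw [hH.eq_of_mem hp]
      exact h
    have e := hπ.adj H hH hn _ _ hq
    rcases ih₁ hp ep e with ⟨h1, h2⟩ | ⟨h1, h2⟩ <;> rcases ih₂ hq e eq with ⟨h3, h4⟩ | ⟨h3, h4⟩
    · exact Or.inl ⟨h1.trans h3, h2.trans h4⟩
    · exact Or.inr ⟨h1.trans h3, by rw [h4, h2]⟩
    · exact Or.inr ⟨by tauto, by rw [← h4, h2]⟩
    · exact Or.inl ⟨by tauto, by simp [h4, h2]⟩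

theorem IsCollapseMap.label_eq (hπ : IsCollapseMap G Z Z' 𝓗 π) (hZ : IsMedian Z)
    (hZ' : IsMedian Z') (hH : IsHyperplane Z H) (hn : H ∉ 𝓗) (hS : IsHalfspace Z H S)
    {a b c d : V} (h : (a, b) ∈ H) (h' : (c, d) ∈ H) (ha : a ∈ S) (hc : c ∈ S)
    (e : Z'.Adj (π a) (π b)) (e' : Z'.Adj (π c) (π d)) : label Φ e = label Φ e' := by
  have h2 := h'
  rw [hH.eq_of_mem h] at h2
  rcases hπ.label_parallel Φ hZ hZ' hH hn hS h h2 e e' with h3 | h3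
  · exact h3.2
  · exact absurd hc (h3.1.1 ha)

theorem IsCollapseMap.label_fst_eq (hπ : IsCollapseMap G Z Z' 𝓗 π) (hZ : IsMedian Z)
    (hZ' : IsMedian Z') (hH : IsHyperplane Z H) (hn : H ∉ 𝓗)
    {a b c d : V} (h : (a, b) ∈ H) (h' : (c, d) ∈ H)
    (e : Z'.Adj (π a) (π b)) (e' : Z'.Adj (π c) (π d)) : (label Φ e).1 = (label Φ e').1 := by
  obtain ⟨S, hS, -⟩ := hZ.exists_halfspace hH h
  rw [hH.eq_of_mem h] at h'
  rcases hπ.label_parallel Φ hZ hZ' hH hn hS h h' e e' with h3 | h3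
  · rw [h3.2]
  · rw [h3.2]

theorem IsInvariantFamily.smul_notMem (h𝓗 : IsInvariantFamily G Z 𝓗) (hn : H ∉ 𝓗) (g : G) :
    g • H ∉ 𝓗 := by
  intro h
  have := h𝓗.invariant g⁻¹ _ h
  rw [inv_smul_smul] at this
  exact hn this

theorem IsCollapseMap.label_smul_eq (hπ : IsCollapseMap G Z Z' 𝓗 π) (hZ : IsMedian Z)
    (hZ' : IsMedian Z') (hG : IsIsometric G Z) (h𝓗 : IsInvariantFamily G Z 𝓗)
    (hH : IsHyperplane Z H) (hn : H ∉ 𝓗) (hS : IsHalfspace Z H S)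
    {a b c d : V} (h : (a, b) ∈ H) (h' : (c, d) ∈ g • H) (ha : a ∈ S) (hc : c ∈ g • S)
    (e : Z'.Adj (π a) (π b)) (e' : Z'.Adj (π c) (π d)) : label Φ e = label Φ e' := by
  have hga : (g • a, g • b) ∈ g • H := Set.smul_mem_smul_set h
  have eg := hπ.adj _ (hH.smul hG g) (h𝓗.smul_notMem hn g) _ _ hga
  have eg' := eg
  rw [hπ.smul, hπ.smul] at eg'
  rw [← hπ.label_eq Φ hZ hZ' (hH.smul hG g) (h𝓗.smul_notMem hn g) (hS.smul hG g) hga h'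
    (Set.smul_mem_smul_set ha) hc eg e', ← label_smul Φ g e eg']
  exact label_congr Φ _ _ (hπ.smul _ _).symm (hπ.smul _ _).symm

theorem IsCollapseMap.label_smul_fst_eq (hπ : IsCollapseMap G Z Z' 𝓗 π) (hZ : IsMedian Z)
    (hZ' : IsMedian Z') (hG : IsIsometric G Z) (h𝓗 : IsInvariantFamily G Z 𝓗)
    (hH : IsHyperplane Z H) (hn : H ∉ 𝓗) {a b c d : V} (h : (a, b) ∈ H) (h' : (c, d) ∈ g • H)
    (e : Z'.Adj (π a) (π b)) (e' : Z'.Adj (π c) (π d)) : (label Φ e).1 = (label Φ e').1 := by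
  obtain ⟨S, hS, ha, hb⟩ := hZ.exists_halfspace hH h
  have hga : (g • a, g • b) ∈ g • H := Set.smul_mem_smul_set h
  have eg := hπ.adj _ (hH.smul hG g) (h𝓗.smul_notMem hn g) _ _ hga
  rw [hπ.label_smul_eq Φ hZ hZ' hG h𝓗 hH hn hS h hga ha (Set.smul_mem_smul_set ha) e eg]
  exact hπ.label_fst_eq Φ hZ hZ' (hH.smul hG g) (h𝓗.smul_notMem hn g) hga h' eg e'

theorem Prod.eq_or_eq_not {p q : W × Bool} (h : p.1 = q.1) : p = q ∨ q = (p.1, !p.2) := by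
  obtain ⟨a, x⟩ := p
  obtain ⟨b, y⟩ := q
  obtain rfl : a = b := h
  cases x <;> cases y <;> simp

-- If `g` exchanged the sides, an edge dual to `H` and its reverse would have the same label, but
-- their signs differ.
include Φ in
theorem IsCollapseMap.two_sided (hπ : IsCollapseMap G Z Z' 𝓗 π) (hZ : IsMedian Z)
    (hZ' : IsMedian Z') (hG : IsIsometric G Z) (h𝓗 : IsInvariantFamily G Z 𝓗)
    (hH : IsHyperplane Z H) (hn : H ∉ 𝓗) (hS : IsHalfspace Z H S) (hg : g • H = H) :
    g • S = S := by
  have hgS := hS.smul hG g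
  rw [hg] at hgS
  rcases hZ.eq_or_eq_compl hH hS hgS with h | h
  · exact h
  · exfalso
    obtain ⟨a, b, hab, ha, hb⟩ : ∃ a b, (a, b) ∈ H ∧ a ∈ S ∧ b ∉ S := by
      obtain ⟨x, y, hxy⟩ := hH.nonempty
      have := ((hZ.mem_hyperplane_iff hH hS).1 hxy).2
      by_cases hx : x ∈ S
      · exact ⟨x, y, hxy, hx, this.1 hx⟩
      · exact ⟨y, x, hH.swap_mem hxy, by tauto, hx⟩
    have e := hπ.adj H hH hn _ _ hab
    have := hπ.label_smul_eq Φ (g := g) hZ hZ' hG h𝓗 hH hn hS hab (by rw [hg]; exact hH.swap_mem hab)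
      ha (by rw [h]; exact hb) e e.symm
    rw [label_swap Φ e] at this
    have := congrArg Prod.snd this
    simp at this

/-- The image in the range of a collapse of two transverse hyperplanes that are not collapsed. -/
theorem IsCollapseMap.adj_label_of_transverse (hπ : IsCollapseMap G Z Z' 𝓗 π) (hZ : IsMedian Z)
    (hZ' : IsMedian Z') (hH : IsHyperplane Z H) (hn : H ∉ 𝓗) (hK : IsHyperplane Z K)
    (hn' : K ∉ 𝓗) (h : Transverse Z H K) {a b c d : V} (hab : (a, b) ∈ H) (hcd : (c, d) ∈ K)
    (e : Z'.Adj (π a) (π b)) (e' : Z'.Adj (π c) (π d)) :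
    Γ.Adj (label Φ e).1 (label Φ e').1 := by
  obtain ⟨S, hS, -⟩ := hZ.exists_halfspace hH hab
  have hne := h.ne hZ hH
  obtain ⟨x, y, z, w, hop, hxy, hxz⟩ := h
  have hzw := hH.mem_of_opposite hxy hop
  have hyw := hK.mem_of_opposite hxz hop.transpose
  have hxzS := hZ.mem_iff_of_notMem hH hS hop.2.2.1
    fun h' => hne (hH.eq_of_mem_of_mem hK h' hxz)
  have s1 := ((hZ.mem_hyperplane_iff hH hS).1 hxy).2
  have s2 := ((hZ.mem_hyperplane_iff hH hS).1 hzw).2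
  have e1 := hπ.adj H hH hn _ _ hxy
  have e2 := hπ.adj K hK hn' _ _ hxz
  have hop' : Opposite Z' (π x, π y) (π z, π w) := by
    refine ⟨e1, hπ.adj H hH hn _ _ hzw, e2, hπ.adj K hK hn' _ _ hyw, fun h' => ?_, fun h' => ?_⟩
    · have := hπ.mem_iff H hH hn S hS _ _ h'
      simp only at hxzS
      tauto
    · have := hπ.mem_iff H hH hn S hS _ _ h'
      simp only at hxzS
      tauto
  rw [← hπ.label_fst_eq Φ hZ hZ' hH hn hxy hab e1 e, ← hπ.label_fst_eq Φ hZ hZ' hK hn' hxz hcd e2 e']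
  exact hop'.adj_label Φ hZ' e1 e2

-- The generators of transverse hyperplanes are adjacent in `Γ`, while `H` and `gH` have the same
-- generator.
include Φ in
theorem IsCollapseMap.not_transverse_smul (hπ : IsCollapseMap G Z Z' 𝓗 π) (hZ : IsMedian Z)
    (hZ' : IsMedian Z') (hG : IsIsometric G Z) (h𝓗 : IsInvariantFamily G Z 𝓗)
    (hH : IsHyperplane Z H) (hn : H ∉ 𝓗) : ¬ Transverse Z H (g • H) := by
  intro h
  obtain ⟨x, y, hxy⟩ := hH.nonempty
  have hg : (g • x, g • y) ∈ g • H := Set.smul_mem_smul_set hxy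
  have hH' := hH.smul hG g
  have hn' := h𝓗.smul_notMem hn g
  have e := hπ.adj H hH hn _ _ hxy
  have e' := hπ.adj _ hH' hn' _ _ hg
  refine (hπ.adj_label_of_transverse Φ hZ hZ' hH hn hH' hn' h hxy hg e e').ne ?_
  exact hπ.label_smul_fst_eq Φ hZ hZ' hG h𝓗 hH hn hxy hg e e'

include Φ in
theorem IsCollapseMap.inter_smul_nonempty (hπ : IsCollapseMap G Z Z' 𝓗 π) (hZ : IsMedian Z)
    (hZ' : IsMedian Z') (hf' : IsFree G Z') (hG : IsIsometric G Z)
    (h𝓗 : IsInvariantFamily G Z 𝓗) (hH : IsHyperplane Z H) (hn : H ∉ 𝓗) (hS : IsHalfspace Z H S)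
    (hc : (carrier H ∩ carrier (g • H)).Nonempty) : (S ∩ g • S).Nonempty := by
  have hH' := hH.smul hG g
  have hn' := h𝓗.smul_notMem hn g
  have hS' := hS.smul hG g
  by_cases hg : g • H = H
  · rw [hπ.two_sided Φ hZ hZ' hG h𝓗 hH hn hS hg, Set.inter_self]
    exact hS.nonempty
  obtain ⟨x, ⟨y, hy⟩, ⟨z, hz⟩⟩ := hc
  have e := hπ.adj H hH hn _ _ hy
  have e' := hπ.adj _ hH' hn' _ _ hz
  have hyz : π y ≠ π z := fun h => hg
    (hπ.hyperplane_eq _ _ hH hH' hn hn' _ _ _ _ hy hz rfl h).symm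
  have hl : label Φ e ≠ label Φ e' := fun h => hyz (eq_of_label_eq Φ hf' e e' h)
  have hyK := hZ.mem_iff_of_notMem hH' hS' (hH.adj hy)
    fun h => hg (hH.eq_of_mem_of_mem hH' hy h).symm
  have hzH := hZ.mem_iff_of_notMem hH hS (hH'.adj hz)
    fun h => hg (hH'.eq_of_mem_of_mem hH hz h)
  have sy := ((hZ.mem_hyperplane_iff hH hS).1 hy).2
  have sz := ((hZ.mem_hyperplane_iff hH' hS').1 hz).2
  by_cases hx : x ∈ S
  · by_cases hx' : x ∈ g • S
    · exact ⟨x, hx, hx'⟩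
    · exact ⟨z, hzH.1 hx, not_not.1 (mt sz.2 hx')⟩
  · by_cases hx' : x ∈ g • S
    · exact ⟨y, not_not.1 (mt sy.2 hx), hyK.1 hx'⟩
    -- The only bad position: `x` lies outside both `S` and `g • S`, so the two edges leave `x` in
    -- corresponding directions and have the same label.
    · refine absurd (hπ.label_smul_eq Φ hZ hZ' hG h𝓗 hH hn (hZ.isHalfspace_compl hH hS) hy hz hx ?_
        e e') hl
      rw [Set.smul_set_compl]
      exact hx'

/-- Two hyperplanes in the same orbit of a strongly collapsible family are equal if their carriers
have intersecting images in the range of the collapse. -/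
theorem IsCollapseMap.smul_eq_of_mem_carrier (hπ : IsCollapseMap G Z Z' 𝓗 π)
    (h𝓗 : IsStronglyCollapsible G Z 𝓗) (hZ : IsMedian Z) (hK : K ∈ 𝓗) {x y : V} (hx : x ∈ carrier K)
    (hy : y ∈ carrier (g • K)) (hxy : π x = π y) : g • K = K := by
  by_contra hne
  refine h𝓗.strong K hK g hne ?_
  -- A kept hyperplane separating the carriers would separate `x` from `y`, which have the same
  -- image; hence the whole separator is collapsed, against strong collapsibility.
  rintro M ⟨hM, S, T, hS, hT, hST, h1, h2⟩
  by_contra hMn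
  have := (hπ.mem_iff M hM hMn S hS x y hxy).1 (h1 hx)
  rcases hZ.eq_or_eq_compl hM hS hT with rfl | rfl
  · exact hST rfl
  · exact h2 hy this

-- The collapse is chosen to keep `H`, with no control on `K`. If `K` is kept, generators decide. If
-- `K` is collapsed, the contact of `gH` with `K` is moved over a vertex `a` where `H` crosses `K`,
-- by an element that has to fix `K`.
include Φ in
theorem IsCollapseMap.transverse_smul (hπ : IsCollapseMap G Z Z' 𝓗 π) (hZ : IsMedian Z)
    (hZ' : IsMedian Z') (hf' : IsFree G Z') (hG : IsIsometric G Z) (hG' : IsIsometric G Z')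
    (h𝓗 : IsStronglyCollapsible G Z 𝓗) (hH : IsHyperplane Z H) (hn : H ∉ 𝓗)
    (hK : IsHyperplane Z K) (h : Transverse Z H K)
    (hc : (carrier (g • H) ∩ carrier K).Nonempty) : Transverse Z (g • H) K := by
  have h𝓗' := h𝓗.toIsInvariantFamily
  obtain ⟨x, ⟨y, hy⟩, ⟨z, hz⟩⟩ := hc
  have ey := hπ.adj _ (hH.smul hG g) (h𝓗'.smul_notMem hn g) _ _ hy
  by_cases hKn : K ∈ 𝓗
  · have ht := h
    obtain ⟨a, b, c, d, hop, hab, hac⟩ := h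
    have hbd := hK.mem_of_opposite hac hop.transpose
    obtain ⟨k, hk⟩ := exists_smul_eq_of_iso Φ (π x) (π a)
    have hkK : k • K = K := hπ.smul_eq_of_mem_carrier h𝓗 hZ hKn (x := a) (y := k • x) ⟨c, hac⟩
      ⟨k • z, Set.smul_mem_smul_set (a := k) hz⟩ (by rw [hπ.smul, hk])
    suffices hs : Transverse Z (k • g • H) K by
      have := hs.smul hG k⁻¹
      rwa [inv_smul_smul, inv_smul_eq_iff.2 hkK.symm] at this
    have hky : (k • x, k • y) ∈ k • g • H := Set.smul_mem_smul_set (a := k) hy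
    have hn' := h𝓗'.smul_notMem (h𝓗'.smul_notMem hn g) k
    have hH' := (hH.smul hG g).smul hG k
    have e := hπ.adj H hH hn _ _ hab
    have e' := hπ.adj _ hH' hn' _ _ hky
    have hxa : π (k • x) = π a := by rw [hπ.smul, hk]
    have hl : (label Φ e).1 = (label Φ e').1 := by
      refine hπ.label_smul_fst_eq Φ (g := k * g) hZ hZ' hG h𝓗' hH hn hab ?_ e e'
      rwa [mul_smul]
    -- The edges from `π a` dual to the images of `H` and `k • g • H` have the same generator. With
    -- equal signs they coincide and the hyperplanes are equal. With opposite signs, an element `r`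
    -- carries the reverse of the first edge to the second; as `K` also passes through `b`, `r`
    -- fixes `K`, and the crossing of `H` with `K` is carried to one of `k • g • H` with `K`.
    rcases Prod.eq_or_eq_not hl with hl | hl
    · obtain ⟨r, h1, h2⟩ := (label_eq_iff Φ _ _).1 hl
      rw [hf'.eq_one_of_smul_eq (h1.trans hxa), one_smul] at h2
      rwa [← hπ.hyperplane_eq _ _ hH hH' hn hn' _ _ _ _ hab hky hxa.symm h2]
    · rw [← label_swap] at hl
      obtain ⟨r, h1, h2⟩ := (label_eq_iff Φ _ _).1 hl.symm
      have hrK : r • K = K := hπ.smul_eq_of_mem_carrier h𝓗 hZ hKn (x := a) (y := r • b) ⟨c, hac⟩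
        ⟨r • d, Set.smul_mem_smul_set (a := r) hbd⟩ (by rw [hπ.smul, h1, hxa])
      have hra : (r • b, r • a) ∈ r • H := Set.smul_mem_smul_set (a := r) (hH.swap_mem hab)
      have := hπ.hyperplane_eq _ _ (hH.smul hG r) hH' (h𝓗'.smul_notMem hn r) hn' _ _ _ _ hra hky
        (by rw [hπ.smul, h1]) (by rw [hπ.smul, h2])
      have hs := ht.smul hG r
      rwa [this, hrK] at hs
  · have ez := hπ.adj _ hK hKn _ _ hz
    obtain ⟨a, b, hab⟩ := hH.nonempty
    have e := hπ.adj H hH hn _ _ hab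
    have hadj := hπ.adj_label_of_transverse Φ hZ hZ' hH hn hK hKn h hab hz e ez
    rw [hπ.label_smul_fst_eq Φ hZ hZ' hG h𝓗' hH hn hab hy e ey] at hadj
    obtain ⟨w, hw⟩ := exists_opposite_of_adj_label Φ hZ' hG' hf' ey ez hadj
    exact hπ.transverse _ _ (hH.smul hG g) hK (h𝓗'.smul_notMem hn g) hKn _ _ _ _ hy hz hw

end Cospecial

/-! ### Cospeciality, with one collapse for each hyperplane. -/

theorem IsCospatial.exists_isCollapseMap {W : Type v} {Γ : SimpleGraph W} {V : Type u}
    {Z : SimpleGraph V} [MulAction (RAAG Γ) V] (h : IsCospatial Γ Z) {H : Set (V × V)}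
    (hH : IsHyperplane Z H) :
    ∃ (𝓗 : Set (Set (V × V))) (V' : Type u) (Z' : SimpleGraph V') (_ : MulAction (RAAG Γ) V')
      (π : V → V'), IsStronglyCollapsible (RAAG Γ) Z 𝓗 ∧ H ∉ 𝓗 ∧
        IsCollapseMap (RAAG Γ) Z Z' 𝓗 π ∧ IsSalvettiLike Γ Z' := by
  obtain ⟨𝓗, h𝓗, hn, hs⟩ := h.exists_collapse H hH
  have hc := isCollapseMap_collapseMap h.median h.isometric h𝓗.toIsInvariantFamily
  exact ⟨𝓗, _, _, collapseAction h.isometric h𝓗.toIsInvariantFamily, _, h𝓗, hn, hc, hs⟩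

theorem IsCospatial.isCospecial {W : Type v} {Γ : SimpleGraph W} {V : Type u}
    {Z : SimpleGraph V} [MulAction (RAAG Γ) V] (h : IsCospatial Γ Z) :
    IsCospecial (RAAG Γ) Z where
  toIsFreeCAT0Action := h.toIsFreeCAT0Action
  two_sided g H hH hg S hS := by
    obtain ⟨𝓗, V', Z', _, π, h𝓗, hn, hπ, hs⟩ := h.exists_isCollapseMap hH
    obtain ⟨Φ⟩ := hs.iso
    exact hπ.two_sided Φ h.median hs.median h.isometric h𝓗.toIsInvariantFamily hH hn hS hg
  no_self_intersection g H hH := by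
    obtain ⟨𝓗, V', Z', _, π, h𝓗, hn, hπ, hs⟩ := h.exists_isCollapseMap hH
    obtain ⟨Φ⟩ := hs.iso
    exact hπ.not_transverse_smul Φ h.median hs.median h.isometric h𝓗.toIsInvariantFamily hH hn
  no_direct_self_osculation g H hH hc S hS := by
    obtain ⟨𝓗, V', Z', _, π, h𝓗, hn, hπ, hs⟩ := h.exists_isCollapseMap hH
    obtain ⟨Φ⟩ := hs.iso
    exact hπ.inter_smul_nonempty Φ h.median hs.median hs.free h.isometric
      h𝓗.toIsInvariantFamily hH hn hS hc
  no_inter_osculation g H K hH hK ht hc := by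
    obtain ⟨𝓗, V', Z', _, π, h𝓗, hn, hπ, hs⟩ := h.exists_isCollapseMap hH
    obtain ⟨Φ⟩ := hs.iso
    exact hπ.transverse_smul Φ h.median hs.median hs.free h.isometric hs.isometric h𝓗 hH hn hK ht hc


/-! ## Translations of the square grid -/

section Grid

theorem squareGrid_adj {p q : ℤ × ℤ} :
    squareGrid.Adj p q ↔ (p.1 - q.1).natAbs + (p.2 - q.2).natAbs = 1 := by
  rw [SimpleGraph.boxProd_adj]
  simp only [SimpleGraph.hasse_adj, Order.covBy_iff_add_one_eq]
  omega

theorem exists_walk_squareGrid (p q : ℤ × ℤ) :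
    ∃ w : squareGrid.Walk p q, w.length = (p.1 - q.1).natAbs + (p.2 - q.2).natAbs := by
  obtain ⟨n, hn⟩ : ∃ n, (p.1 - q.1).natAbs + (p.2 - q.2).natAbs = n := ⟨_, rfl⟩
  induction n generalizing p with
  | zero =>
    obtain rfl : p = q := Prod.ext (by omega) (by omega)
    exact ⟨SimpleGraph.Walk.nil, by simp⟩
  | succ n ih =>
    obtain ⟨r, hr, hrn⟩ : ∃ r, squareGrid.Adj p r ∧
        (r.1 - q.1).natAbs + (r.2 - q.2).natAbs = n := by
      simp only [squareGrid_adj]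
      rcases lt_trichotomy p.1 q.1 with h | h | h
      · exact ⟨(p.1 + 1, p.2), by simp, by simp only; omega⟩
      · rcases lt_trichotomy p.2 q.2 with h' | h' | h'
        · exact ⟨(p.1, p.2 + 1), by simp, by simp only; omega⟩
        · omega
        · exact ⟨(p.1, p.2 - 1), by simp, by simp only; omega⟩
      · exact ⟨(p.1 - 1, p.2), by simp, by simp only; omega⟩
    obtain ⟨w, hw⟩ := ih r hrn
    exact ⟨SimpleGraph.Walk.cons hr w, by rw [SimpleGraph.Walk.length_cons, hw, hrn, hn]⟩

theorem le_length_squareGrid {p q : ℤ × ℤ} (w : squareGrid.Walk p q) :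
    (p.1 - q.1).natAbs + (p.2 - q.2).natAbs ≤ w.length := by
  induction w with
  | nil => simp
  | cons h w ih =>
    rw [squareGrid_adj] at h
    rw [SimpleGraph.Walk.length_cons]
    omega

theorem squareGrid_connected : squareGrid.Connected :=
  ⟨fun p q => ⟨(exists_walk_squareGrid p q).choose⟩⟩

theorem squareGrid_dist (p q : ℤ × ℤ) :
    squareGrid.dist p q = (p.1 - q.1).natAbs + (p.2 - q.2).natAbs := by
  refine le_antisymm ?_ ?_
  · obtain ⟨w, hw⟩ := exists_walk_squareGrid p q
    exact hw ▸ SimpleGraph.dist_le w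
  · obtain ⟨w, hw⟩ := squareGrid_connected.exists_walk_length_eq_dist p q
    exact hw ▸ le_length_squareGrid w

theorem Int.exists_median (a b c : ℤ) : ∃ m : ℤ,
    (a - b).natAbs = (a - m).natAbs + (m - b).natAbs ∧
    (b - c).natAbs = (b - m).natAbs + (m - c).natAbs ∧
    (a - c).natAbs = (a - m).natAbs + (m - c).natAbs := by
  rcases le_total a b with h | h <;> rcases le_total b c with h' | h' <;>
    rcases le_total a c with h'' | h''
  all_goals first
    | exact ⟨a, by omega, by omega, by omega⟩
    | exact ⟨b, by omega, by omega, by omega⟩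
    | exact ⟨c, by omega, by omega, by omega⟩

theorem Int.mem_uIcc_of_natAbs {a b m : ℤ}
    (h : (a - m).natAbs + (m - b).natAbs ≤ (a - b).natAbs) : min a b ≤ m ∧ m ≤ max a b := by
  omega

theorem Int.eq_median {a b c m : ℤ}
    (h1 : (a - m).natAbs + (m - b).natAbs ≤ (a - b).natAbs)
    (h2 : (b - m).natAbs + (m - c).natAbs ≤ (b - c).natAbs)
    (h3 : (a - m).natAbs + (m - c).natAbs ≤ (a - c).natAbs) :
    m = max (min a b) (min (max a b) c) := by
  have e1 := Int.mem_uIcc_of_natAbs h1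
  have e2 := Int.mem_uIcc_of_natAbs h2
  have e3 := Int.mem_uIcc_of_natAbs h3
  clear h1 h2 h3
  omega

theorem Int.median_unique {a b c m m' : ℤ}
    (h1 : (a - m).natAbs + (m - b).natAbs ≤ (a - b).natAbs)
    (h2 : (b - m).natAbs + (m - c).natAbs ≤ (b - c).natAbs)
    (h3 : (a - m).natAbs + (m - c).natAbs ≤ (a - c).natAbs)
    (h1' : (a - m').natAbs + (m' - b).natAbs ≤ (a - b).natAbs)
    (h2' : (b - m').natAbs + (m' - c).natAbs ≤ (b - c).natAbs)
    (h3' : (a - m').natAbs + (m' - c).natAbs ≤ (a - c).natAbs) : m = m' :=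
  (Int.eq_median h1 h2 h3).trans (Int.eq_median h1' h2' h3').symm

theorem isMedian_squareGrid : IsMedian squareGrid := by
  refine ⟨squareGrid_connected, fun x y z => ?_⟩
  simp only [squareGrid_dist]
  obtain ⟨m, h1, h2, h3⟩ := Int.exists_median x.1 y.1 z.1
  obtain ⟨n, k1, k2, k3⟩ := Int.exists_median x.2 y.2 z.2
  refine ⟨(m, n), ⟨by linarith, by linarith, by linarith⟩, ?_⟩
  have tri : ∀ a b c : ℤ, (a - c).natAbs ≤ (a - b).natAbs + (b - c).natAbs := by
    intro a b c
    omega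
  rintro ⟨m', n'⟩ ⟨e1, e2, e3⟩
  simp only at e1 e2 e3
  have t1 := tri x.1 m' y.1
  have t2 := tri y.1 m' z.1
  have t3 := tri x.1 m' z.1
  have t4 := tri x.2 n' y.2
  have t5 := tri y.2 n' z.2
  have t6 := tri x.2 n' z.2
  refine Prod.ext (Int.median_unique (a := x.1) (b := y.1) (c := z.1) ?_ ?_ ?_ h1.ge h2.ge h3.ge)
    (Int.median_unique (a := x.2) (b := y.2) (c := z.2) ?_ ?_ ?_ k1.ge k2.ge k3.ge) <;>
  simp only <;> linarith

theorem exists_halfspace_squareGrid {H : Set ((ℤ × ℤ) × (ℤ × ℤ))}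
    (hH : IsHyperplane squareGrid H) : ∃ i : ℤ, IsHalfspace squareGrid H {p | p.1 ≤ i} ∨
      IsHalfspace squareGrid H {p | p.2 ≤ i} := by
  have key : ∀ a b, squareGrid.Adj a b → (a, b) ∈ H → IsHalfspace squareGrid H
      {x | (x.1 - a.1).natAbs + (x.2 - a.2).natAbs < (x.1 - b.1).natAbs + (x.2 - b.2).natAbs} := by
    intro a b hab h
    have := isMedian_squareGrid.isHalfspace_nearer hab
    rw [← hH.eq_of_mem h] at this
    simpa only [nearer, squareGrid_dist] using this
  obtain ⟨a, b, h⟩ := hH.nonempty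
  have hab := hH.adj h
  have h1 := key a b hab h
  have h2 := key b a hab.symm (hH.swap_mem h)
  rw [squareGrid_adj] at hab
  have cases : (a.1 + 1 = b.1 ∧ a.2 = b.2) ∨ (b.1 + 1 = a.1 ∧ a.2 = b.2) ∨
      (a.1 = b.1 ∧ a.2 + 1 = b.2) ∨ (a.1 = b.1 ∧ b.2 + 1 = a.2) := by omega
  rcases cases with h' | h' | h' | h'
  · refine ⟨a.1, Or.inl ?_⟩
    convert h1 using 3
    omega
  · refine ⟨b.1, Or.inl ?_⟩
    convert h2 using 3
    omega
  · refine ⟨a.2, Or.inr ?_⟩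
    convert h1 using 3
    omega
  · refine ⟨b.2, Or.inr ?_⟩
    convert h2 using 3
    omega

variable {G : Type*} [Group G] [MulAction G (ℤ × ℤ)] {τ : G → ℤ × ℤ}

theorem isIsometric_squareGrid (hτ : ∀ (g : G) (p : ℤ × ℤ), g • p = p + τ g) :
    IsIsometric G squareGrid := by
  intro g x y
  rw [squareGrid_adj, squareGrid_adj, hτ, hτ]
  simp only [Prod.fst_add, Prod.snd_add, add_sub_add_right_eq_sub]

/-- A cube invariant under a nonzero translation would contain infinitely many vertices. -/
theorem isFree_squareGrid (hτ : ∀ (g : G) (p : ℤ × ℤ), g • p = p + τ g)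
    (hinj : ∀ g, τ g = 0 → g = 1) : IsFree G squareGrid := by
  intro g n c _ h
  refine hinj g ?_
  by_contra hne
  have hmem : ∀ k : ℕ, c (fun _ => false) + k • τ g ∈ Set.range c := by
    intro k
    induction k with
    | zero => simp
    | succ k ih =>
      have := Set.smul_mem_smul_set (a := g) ih
      rw [h, hτ] at this
      rwa [succ_nsmul, ← add_assoc]
  refine Set.infinite_of_injective_forall_mem (fun k l hkl => ?_) hmem (Set.finite_range c)
  have := add_left_cancel hkl
  have e1 := congrArg Prod.fst this
  have e2 := congrArg Prod.snd this
  simp only [nsmul_eq_mul] at e1 e2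
  by_contra hkl'
  have hkl'' : (k : ℤ) ≠ l := by exact_mod_cast hkl'
  refine hne (Prod.ext ?_ ?_)
  · by_contra h0
    exact hkl'' (mul_right_cancel₀ h0 e1)
  · by_contra h0
    exact hkl'' (mul_right_cancel₀ h0 e2)

/-- The `n` edges of a cube at its origin reach distinct neighbours, and a grid vertex has four. The
bound is not sharp, but any bound serves for compactness. -/
theorem IsCube.dim_le_four {n : ℕ} {c : (Fin n → Bool) → ℤ × ℤ} (hc : IsCube squareGrid c) :
    n ≤ 4 := by
  have h1 : ∀ i : Fin n, c (fun j => decide (j = i)) - c (fun _ => false) ∈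
      ({(1, 0), (-1, 0), (0, 1), (0, -1)} : Finset (ℤ × ℤ)) := by
    intro i
    have h := hc (fun j => decide (j = i)) (fun _ => false)
    have e : hammingDist (fun j => decide (j = i)) (fun _ => false) = 1 := by
      simp [hammingDist, Finset.filter_eq']
    rw [e, squareGrid_dist] at h
    simp only [Finset.mem_insert, Finset.mem_singleton, Prod.ext_iff, Prod.fst_sub, Prod.snd_sub]
    omega
  have h2 := Finset.card_le_card_of_injOn (s := Finset.univ) _ (fun i _ => h1 i) (by
    intro i _ j _ hij
    have h := hc (fun k => decide (k = i)) (fun k => decide (k = j))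
    rw [sub_left_injective hij, SimpleGraph.dist_self] at h
    have := congrFun (hammingDist_eq_zero.1 h.symm) i
    simpa using this)
  simpa using h2

theorem cocompact_squareGrid (hτ : ∀ (g : G) (p : ℤ × ℤ), g • p = p + τ g)
    (hsurj : ∀ v : ℤ × ℤ, Even (v.1 + v.2) → ∃ g, τ g = v) :
    (quotient G squareGrid).IsCompact := by
  have hfin : ∀ n, Finite ((quotient G squareGrid).Cell n) := by
    intro n
    let B := Set.Icc ((-(n + 1) : ℤ), (-(n + 1) : ℤ)) ((n + 1 : ℤ), (n + 1 : ℤ))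
    let T := {c : (Fin n → Bool) → B // IsCube squareGrid fun x => (c x : ℤ × ℤ)}
    have : Finite B := Set.toFinite B
    refine Finite.of_surjective (fun c : T => cell G c.2) fun q => ?_
    obtain ⟨c, hc, rfl⟩ := exists_cell_eq q
    have hbase : ∃ g : G, (c (fun _ => false) + τ g).2 = 0 ∧
        0 ≤ (c (fun _ => false) + τ g).1 ∧ (c (fun _ => false) + τ g).1 ≤ 1 := by
      -- This even translation moves the origin of the cube to `(0, 0)` or `(1, 0)` according to its
      -- parity; the other vertices are within distance `n`, hence in the box `B`.
      obtain ⟨g, hg⟩ := hsurj (-((c fun _ => false).1 - ((c fun _ => false).1 +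
        (c fun _ => false).2) % 2), -(c fun _ => false).2) (by
          rw [Int.even_iff]
          simp only
          omega)
      refine ⟨g, ?_⟩
      rw [hg]
      simp only [Prod.fst_add, Prod.snd_add]
      omega
    obtain ⟨g, h1, h2, h3⟩ := hbase
    have hgc : IsCube squareGrid fun x => g • c x := by
      intro x y
      rw [← hc x y, squareGrid_dist, squareGrid_dist]
      simp only [hτ, Prod.fst_add, Prod.snd_add, add_sub_add_right_eq_sub]
    have hB : ∀ x, g • c x ∈ B := by
      intro x
      have hd := hgc x (fun _ => false)
      have hle := hammingDist_le_card_fintype (x := x) (y := fun _ => false)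
      rw [Fintype.card_fin] at hle
      simp only [hτ] at hd
      rw [squareGrid_dist] at hd
      rw [hτ]
      simp only [B, Set.mem_Icc, Prod.le_def]
      omega
    refine ⟨⟨fun x => ⟨g • c x, hB x⟩, hgc⟩, ?_⟩
    exact (cell_eq_iff _ _).2 ⟨g⁻¹, fun x => inv_smul_smul _ _⟩
  have hdim : ∀ q : Σ n, (quotient G squareGrid).Cell n, q.1 < 5 := by
    rintro ⟨n, q⟩
    obtain ⟨c, hc, -⟩ := exists_cell_eq q
    exact Nat.lt_succ_of_le hc.dim_le_four
  refine Finite.of_injective (β := Σ n : Fin 5, (quotient G squareGrid).Cell n)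
    (fun q => ⟨⟨q.1, hdim q⟩, q.2⟩) ?_
  rintro ⟨n, q⟩ ⟨m, r⟩ h
  simp only [Sigma.mk.injEq, Fin.mk.injEq] at h
  obtain ⟨rfl, h⟩ := h
  rw [eq_of_heq h]

theorem mem_smul_squareGrid (hτ : ∀ (g : G) (p : ℤ × ℤ), g • p = p + τ g) {g : G}
    {S : Set (ℤ × ℤ)} {p : ℤ × ℤ} : p ∈ g • S ↔ p - τ g ∈ S := by
  have : g⁻¹ • p = p - τ g := by
    rw [inv_smul_eq_iff, hτ, sub_add_cancel]
  rw [Set.mem_smul_set_iff_inv_smul_mem, this]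

theorem not_transverse_of_subset {V : Type u} {Z : SimpleGraph V} {H K : Set (V × V)}
    {S T : Set V} (hZ : IsMedian Z) (hH : IsHyperplane Z H) (hK : IsHyperplane Z K)
    (hS : IsHalfspace Z H S) (hT : IsHalfspace Z K T) (h : S ⊆ T) : ¬ Transverse Z H K := by
  intro ht
  obtain ⟨x, hx, hx'⟩ := ht.inter_nonempty hZ hH hK hS (hZ.isHalfspace_compl hK hT)
  exact hx' (h hx)

theorem smul_le_fst (hτ : ∀ (g : G) (p : ℤ × ℤ), g • p = p + τ g) (g : G) (i : ℤ) :
    g • {p : ℤ × ℤ | p.1 ≤ i} = {p | p.1 ≤ i + (τ g).1} := by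
  ext p
  rw [mem_smul_squareGrid hτ]
  simp only [Set.mem_ofPred_eq, Prod.fst_sub]
  omega

theorem smul_le_snd (hτ : ∀ (g : G) (p : ℤ × ℤ), g • p = p + τ g) (g : G) (i : ℤ) :
    g • {p : ℤ × ℤ | p.2 ≤ i} = {p | p.2 ≤ i + (τ g).2} := by
  ext p
  rw [mem_smul_squareGrid hτ]
  simp only [Set.mem_ofPred_eq, Prod.snd_sub]
  omega

theorem not_transverse_of_fst {H K : Set ((ℤ × ℤ) × (ℤ × ℤ))} (hH : IsHyperplane squareGrid H)
    (hK : IsHyperplane squareGrid K) {i j : ℤ} (hS : IsHalfspace squareGrid H {p | p.1 ≤ i})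
    (hT : IsHalfspace squareGrid K {p | p.1 ≤ j}) : ¬ Transverse squareGrid H K := by
  rcases le_total i j with h | h
  · exact not_transverse_of_subset isMedian_squareGrid hH hK hS hT fun p hp => le_trans hp h
  · exact fun ht => not_transverse_of_subset isMedian_squareGrid hK hH hT hS
      (fun p hp => le_trans hp h) ht.symm

theorem not_transverse_of_snd {H K : Set ((ℤ × ℤ) × (ℤ × ℤ))} (hH : IsHyperplane squareGrid H)
    (hK : IsHyperplane squareGrid K) {i j : ℤ} (hS : IsHalfspace squareGrid H {p | p.2 ≤ i})
    (hT : IsHalfspace squareGrid K {p | p.2 ≤ j}) : ¬ Transverse squareGrid H K := by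
  rcases le_total i j with h | h
  · exact not_transverse_of_subset isMedian_squareGrid hH hK hS hT fun p hp => le_trans hp h
  · exact fun ht => not_transverse_of_subset isMedian_squareGrid hK hH hT hS
      (fun p hp => le_trans hp h) ht.symm

theorem transverse_of_fst_of_snd {H K : Set ((ℤ × ℤ) × (ℤ × ℤ))}
    (hH : IsHyperplane squareGrid H) (hK : IsHyperplane squareGrid K) {i j : ℤ}
    (hS : IsHalfspace squareGrid H {p | p.1 ≤ i})
    (hT : IsHalfspace squareGrid K {p | p.2 ≤ j}) : Transverse squareGrid H K :=
  transverse_of_inter_nonempty isMedian_squareGrid hH hK hS hT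
    ⟨(i, j), by simp⟩ ⟨(i, j + 1), by simp⟩ ⟨(i + 1, j), by simp⟩ ⟨(i + 1, j + 1), by simp⟩

/-- Each hyperplane is vertical or horizontal and translations preserve this type. Hyperplanes of
one type have nested halfspaces, and those of different types are always transverse. -/
theorem isCospecial_squareGrid (hτ : ∀ (g : G) (p : ℤ × ℤ), g • p = p + τ g)
    (hinj : ∀ g, τ g = 0 → g = 1) : IsCospecial G squareGrid := by
  have hG := isIsometric_squareGrid hτ
  have hZ := isMedian_squareGrid
  refine ⟨⟨hZ, hG, isFree_squareGrid hτ hinj⟩, ?_, ?_, ?_, ?_⟩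
  · intro g H hH hg S hS
    have key : ∀ T, IsHalfspace squareGrid H T → (T ∩ g • T).Nonempty → g • T = T := by
      intro T hT h
      have hgT := hT.smul hG g
      rw [hg] at hgT
      rcases hZ.eq_or_eq_compl hH hT hgT with h' | h'
      · exact h'
      · rw [h', Set.inter_compl_self] at h
        exact absurd h Set.not_nonempty_empty
    have key2 : ∀ T, IsHalfspace squareGrid H T → (T ∩ g • T).Nonempty → g • S = S := by
      intro T hT h
      rcases hZ.eq_or_eq_compl hH hT hS with rfl | rfl
      · exact key _ hT h
      · rw [Set.smul_set_compl, key _ hT h]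
    obtain ⟨i, h | h⟩ := exists_halfspace_squareGrid hH
    · refine key2 _ h ?_
      rw [smul_le_fst hτ]
      exact ⟨(min i (i + (τ g).1), 0), by simp⟩
    · refine key2 _ h ?_
      rw [smul_le_snd hτ]
      exact ⟨(0, min i (i + (τ g).2)), by simp⟩
  · intro g H hH
    have hgH := hH.smul hG g
    obtain ⟨i, h | h⟩ := exists_halfspace_squareGrid hH
    · have h' := h.smul hG g
      rw [smul_le_fst hτ] at h'
      exact not_transverse_of_fst hH hgH h h'
    · have h' := h.smul hG g
      rw [smul_le_snd hτ] at h'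
      exact not_transverse_of_snd hH hgH h h'
  · intro g H hH _ S hS
    obtain ⟨i, h | h⟩ := exists_halfspace_squareGrid hH
    · rcases hZ.eq_or_eq_compl hH h hS with rfl | rfl
      · rw [smul_le_fst hτ]
        exact ⟨(min i (i + (τ g).1), 0), by simp⟩
      · rw [Set.smul_set_compl, smul_le_fst hτ]
        exact ⟨(max i (i + (τ g).1) + 1, 0), by simp⟩
    · rcases hZ.eq_or_eq_compl hH h hS with rfl | rfl
      · rw [smul_le_snd hτ]
        exact ⟨(0, min i (i + (τ g).2)), by simp⟩
      · rw [Set.smul_set_compl, smul_le_snd hτ]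
        exact ⟨(0, max i (i + (τ g).2) + 1), by simp⟩
  · intro g H K hH hK ht _
    have hgH := hH.smul hG g
    obtain ⟨i, h | h⟩ := exists_halfspace_squareGrid hH
    · have h' := h.smul hG g
      rw [smul_le_fst hτ] at h'
      obtain ⟨j, hj | hj⟩ := exists_halfspace_squareGrid hK
      · exact absurd ht (not_transverse_of_fst hH hK h hj)
      · exact transverse_of_fst_of_snd hgH hK h' hj
    · have h' := h.smul hG g
      rw [smul_le_snd hτ] at h'
      obtain ⟨j, hj | hj⟩ := exists_halfspace_squareGrid hK
      · exact (transverse_of_fst_of_snd hK hgH hj h').symm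
      · exact absurd ht (not_transverse_of_snd hH hK h hj)

end Grid

/-! ## The quotient of the grid by the even translations is not spatial -/

theorem exists_opposite_squareGrid {u v : ℤ × ℤ} (h : squareGrid.Adj u v) :
    ∃ u' v', Opposite squareGrid (u, v) (u', v') ∧ v' - u' = v - u ∧
      Even ((v' - u).1 + (v' - u).2) := by
  rw [squareGrid_adj] at h
  -- The edge is shifted by its own vector rotated by a right angle. The coordinates of the diagonal
  -- then add up to `2 * (v.1 - u.1)`.
  refine ⟨(u.1 - (v.2 - u.2), u.2 + (v.1 - u.1)), (v.1 - (v.2 - u.2), v.2 + (v.1 - u.1)),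
    ⟨?_, ?_, ?_, ?_, ?_, ?_⟩, ?_, ?_⟩
  · simpa only [squareGrid_adj] using h
  · simp only [squareGrid_adj]
    omega
  · simp only [squareGrid_adj]
    omega
  · simp only [squareGrid_adj]
    omega
  · simp only [ne_eq, Prod.ext_iff]
    omega
  · simp only [ne_eq, Prod.ext_iff]
    omega
  · ext <;> simp only [Prod.fst_sub, Prod.snd_sub] <;> ring
  · simp only [Prod.fst_sub, Prod.snd_sub, Int.even_iff]
    omega

section NotSpatial

variable {G : Type*} [Group G] [MulAction G (ℤ × ℤ)] {τ : G → ℤ × ℤ}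
  {A V : Type*} [Group A] [MulAction A V] {Z : SimpleGraph V}

theorem Iso.vertexCell_eq {G A U V : Type*} [Group G] [MulAction G U] [Group A] [MulAction A V]
    {Y : SimpleGraph U} {Z : SimpleGraph V} (Φ : CubicalSet.Iso (quotient G Y) (quotient A Z))
    {u v : U} {a b : V} (h : Y.Adj u v) (h' : Z.Adj a b)
    (he : Φ.equiv 1 (edgeCell G h) = edgeCell A h') :
    Φ.equiv 0 (vertexCell G Y u) = vertexCell A Z a := by
  rw [vertexCell_left h, vertexCell_left h', Φ.map_face, he]

/-- In a complex with the same quotient as the grid, each orbit of hyperplanes contains two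
distinct hyperplanes with intersecting carriers. -/
theorem exists_adjacent_smul_hyperplane (hτ : ∀ (g : G) (p : ℤ × ℤ), g • p = p + τ g)
    (hsurj : ∀ v : ℤ × ℤ, Even (v.1 + v.2) → ∃ g, τ g = v) (hZ : IsMedian Z)
    (hA : IsIsometric A Z)
    (Φ : CubicalSet.Iso (quotient G squareGrid) (quotient A Z)) {K : Set (V × V)}
    (hK : IsHyperplane Z K) :
    ∃ (k g : A), g • k • K ≠ k • K ∧ (carrier (k • K) ∩ carrier (g • k • K)).Nonempty := by
  obtain ⟨p, q, hpq⟩ := hK.nonempty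
  obtain ⟨u, v, huv, he⟩ := exists_edgeCell_eq ((Φ.equiv 1).symm (edgeCell A (hK.adj hpq)))
  obtain ⟨u', v', hop, hsub, heven⟩ := exists_opposite_squareGrid huv
  obtain ⟨a, b, c, d, hop', hs⟩ := exists_square_eq hZ
    (Φ.equiv 2 (cell G (isMedian_squareGrid.isCube_squareMap hop)))
  have e1 : Φ.equiv 1 (edgeCell G huv) = edgeCell A hop'.1 := by
    rw [hop.edgeCell_left isMedian_squareGrid, hop'.edgeCell_left hZ, Φ.map_face, hs]
  have e2 : Φ.equiv 1 (edgeCell G hop.2.1.symm) = edgeCell A hop'.2.1.symm := by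
    rw [edgeCell_swap hop.2.1, edgeCell_swap hop'.2.1, hop.edgeCell_right isMedian_squareGrid,
      hop'.edgeCell_right hZ, Φ.map_face, Φ.map_face, hs]
  obtain ⟨k, rfl, rfl⟩ : ∃ k : A, k • p = a ∧ k • q = b := by
    rw [← edgeCell_eq_iff (hK.adj hpq) hop'.1, ← e1, he, Equiv.apply_symm_apply]
  -- Opposite corners of the grid square are in one orbit, a property visible in the quotient and so
  -- shared by `Z`.
  obtain ⟨g, hg⟩ : ∃ g : A, g • d = k • p := by
    rw [← vertexCell_eq_iff (Z := Z), ← Iso.vertexCell_eq Φ _ _ e1, ← Iso.vertexCell_eq Φ _ _ e2,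
      (Φ.equiv 0).injective.eq_iff, vertexCell_eq_iff]
    obtain ⟨r, hr⟩ := hsurj (-(v' - u)) (by
      rw [Prod.fst_neg, Prod.snd_neg, ← neg_add]
      exact heven.neg)
    exact ⟨r, by rw [hτ, hr]; simp⟩
  have m1 : (k • p, k • q) ∈ k • K := Set.smul_mem_smul_set (a := k) hpq
  have m2 := (hK.smul hA k).mem_of_opposite m1 hop'
  have m3 : (k • p, g • c) ∈ g • k • K := by
    rw [← hg]
    exact Set.smul_mem_smul_set (a := g) ((hK.smul hA k).swap_mem m2)
  -- If `g` fixed `k • K`, the dual edge at `k • p` would be unique, and an edge of the square would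
  -- be identified with the reversed opposite edge. In the grid, a translation would then reverse
  -- the direction of an edge.
  refine ⟨k, g, fun hgk => ?_, ⟨k • p, ⟨_, m1⟩, ⟨_, m3⟩⟩⟩
  rw [hgk] at m3
  have hqc := hZ.edge_unique (hK.smul hA k) m1 m3
  have : edgeCell A hop'.2.1.symm = edgeCell A hop'.1 :=
    (edgeCell_eq_iff _ _).2 ⟨g, hg, hqc.symm⟩
  rw [← e1, ← e2, (Φ.equiv 1).injective.eq_iff, edgeCell_eq_iff] at this
  obtain ⟨r, h1, h2⟩ := this
  simp only [hτ] at h1 h2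
  rw [squareGrid_adj] at huv
  simp only [Prod.ext_iff, Prod.fst_sub, Prod.snd_sub, Prod.fst_add, Prod.snd_add] at hsub h1 h2
  omega

theorem not_isSpatial_squareGrid {G : Type} [Group G] [MulAction G (ℤ × ℤ)] {τ : G → ℤ × ℤ}
    (hτ : ∀ (g : G) (p : ℤ × ℤ), g • p = p + τ g)
    (hsurj : ∀ v : ℤ × ℤ, Even (v.1 + v.2) → ∃ g, τ g = v)
    (heven : ∀ g, Even ((τ g).1 + (τ g).2)) : ¬ IsSpatial (quotient G squareGrid) := by
  rintro ⟨W, -, -, Γ, V, Z, _, hZ, ⟨Φ⟩⟩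
  -- Any edge would do: it only provides a hyperplane to which the existence of a collapse applies.
  have hadj : squareGrid.Adj (0, 0) (1, 0) := squareGrid_adj.2 (by simp)
  obtain ⟨a, b, hab, -⟩ := exists_edgeCell_eq (Φ.equiv 1 (edgeCell G hadj))
  obtain ⟨𝓗, V', Z', _, π, h𝓗, -, hπ, hs⟩ := hZ.exists_isCollapseMap (IsHyperplane.of_adj hab)
  have hempty : ∀ K, K ∉ 𝓗 := by
    intro K hK
    obtain ⟨k, g, hne, x, hx, hx'⟩ := exists_adjacent_smul_hyperplane hτ hsurj hZ.median
      hZ.isometric Φ (h𝓗.hyperplane K hK)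
    exact hne (hπ.smul_eq_of_mem_carrier h𝓗 hZ.median (h𝓗.invariant k K hK) hx hx' rfl)
  obtain ⟨x, hx⟩ := exists_vertexCell_eq (Φ.equiv 0 (vertexCell G squareGrid (0, 0)))
  obtain ⟨y, hy⟩ := exists_vertexCell_eq (Φ.equiv 0 (vertexCell G squareGrid (1, 0)))
  obtain ⟨Ψ⟩ := hs.iso
  obtain ⟨g, hg⟩ := exists_smul_eq_of_iso Ψ (π x) (π y)
  -- Nothing is collapsed, so `π` is injective and transitivity on `Z'` passes back to `Z`.
  have hgx : g • x = y := by
    by_contra hne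
    obtain ⟨H, S, hH, hS, h1, h2⟩ := hZ.median.exists_separating hne
    exact h2 ((hπ.mem_iff H hH (hempty H) S hS _ _ (by rw [hπ.smul, hg])).1 h1)
  have hxy := (vertexCell_eq_iff (G := RAAG Γ) (Z := Z)).2 ⟨g, hgx⟩
  rw [hx, hy, (Φ.equiv 0).injective.eq_iff, vertexCell_eq_iff] at hxy
  obtain ⟨r, hr⟩ := hxy
  rw [hτ] at hr
  have := heven r
  simp only [Prod.ext_iff, Prod.fst_add, Prod.snd_add] at hr
  rw [Int.even_iff] at this
  omega

end NotSpatial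

/-! ## The diagonal action of `ℤ²` on the grid -/

/-- The translation vectors of the elements of `ℤ² = ⟨(1,1), (-1,1)⟩`. -/
def diagonalHom : RAAG edgeGraph →* Multiplicative (ℤ × ℤ) :=
  PresentedGroup.toGroup (f := fun i : Fin 2 => Multiplicative.ofAdd (![(1, 1), (-1, 1)] i)) (by
    rintro r ⟨a, b, -, rfl⟩
    simp)

theorem diagonalHom_of (i : Fin 2) :
    diagonalHom (PresentedGroup.of i) = Multiplicative.ofAdd (![((1 : ℤ), (1 : ℤ)), (-1, 1)] i) :=
  PresentedGroup.toGroup.of _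

/-- The action of `ℤ² = ⟨(1,1), (-1,1)⟩` on the plane. -/
abbrev diagonalAction : MulAction (RAAG edgeGraph) (ℤ × ℤ) where
  smul g p := p + (diagonalHom g).toAdd
  one_smul p := by
    change p + (diagonalHom 1).toAdd = p
    simp
  mul_smul g h p := by
    change p + (diagonalHom (g * h)).toAdd = p + (diagonalHom h).toAdd + (diagonalHom g).toAdd
    rw [map_mul, toAdd_mul]
    abel

theorem commute_of_edgeGraph :
    Commute (PresentedGroup.of 0 : RAAG edgeGraph) (PresentedGroup.of 1) := by
  have : (PresentedGroup.of 0 * PresentedGroup.of 1 * (PresentedGroup.of 0)⁻¹ *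
      (PresentedGroup.of 1)⁻¹ : RAAG edgeGraph) = 1 :=
    PresentedGroup.one_of_mem ⟨0, 1, by simp, rfl⟩
  rw [mul_inv_eq_one, mul_inv_eq_iff_eq_mul] at this
  exact this

/-- This normal form gives the kernel of `diagonalHom` and the parity of its values. -/
theorem exists_eq_zpow_mul_zpow (g : RAAG edgeGraph) :
    ∃ m n : ℤ, g = PresentedGroup.of 0 ^ m * PresentedGroup.of 1 ^ n := by
  have hc := commute_of_edgeGraph
  have hg : g ∈ Subgroup.closure (Set.range (PresentedGroup.of : Fin 2 → RAAG edgeGraph)) := by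
    rw [PresentedGroup.closure_range_of]
    trivial
  induction hg using Subgroup.closure_induction with
  | mem x hx =>
    obtain ⟨i, rfl⟩ := hx
    fin_cases i
    · exact ⟨1, 0, by simp⟩
    · exact ⟨0, 1, by simp⟩
  | one => exact ⟨0, 0, by simp⟩
  | mul x y _ _ hx hy =>
    obtain ⟨m, n, rfl⟩ := hx
    obtain ⟨m', n', rfl⟩ := hy
    refine ⟨m + m', n + n', ?_⟩
    rw [zpow_add, zpow_add, mul_assoc, ← mul_assoc (_ ^ n), ← (hc.zpow_zpow m' n).eq]
    simp only [mul_assoc]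
  | inv x _ hx =>
    obtain ⟨m, n, rfl⟩ := hx
    refine ⟨-m, -n, ?_⟩
    rw [mul_inv_rev, zpow_neg, zpow_neg, ((hc.zpow_zpow m n).inv_inv).eq]

theorem diagonalHom_zpow (m n : ℤ) : (diagonalHom (PresentedGroup.of 0 ^ m *
    PresentedGroup.of 1 ^ n)).toAdd = (m - n, m + n) := by
  rw [map_mul, map_zpow, map_zpow, diagonalHom_of, diagonalHom_of, toAdd_mul, toAdd_zpow,
    toAdd_zpow]
  ext <;> simp
  ring

end CubeCx

open CubeCx
theorem lemma5p6 :
    -- Every cospatial action is cospecial.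
    (∀ {W : Type v} [Finite W] [Nonempty W] (Γ : SimpleGraph W) {V : Type u} (Z : SimpleGraph V)
      [MulAction (RAAG Γ) V], IsCospatial Γ Z → IsCospecial (RAAG Γ) Z) ∧
    -- Every spatial cube complex is special.
    (∀ X : CubicalSet.{u}, IsSpatial X → IsSpecial X) ∧
    -- The converse fails, for the action of `ℤ² = ⟨(1,1), (-1,1)⟩` on the plane and its quotient.
    (∃ _ : MulAction (RAAG edgeGraph) (ℤ × ℤ),
      (∀ p : ℤ × ℤ, (PresentedGroup.of 0 : RAAG edgeGraph) • p = p + (1, 1)) ∧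
      (∀ p : ℤ × ℤ, (PresentedGroup.of 1 : RAAG edgeGraph) • p = p + (-1, 1)) ∧
      IsGeometric (RAAG edgeGraph) squareGrid ∧
      IsCospecial (RAAG edgeGraph) squareGrid ∧
      ¬ IsCospatial edgeGraph squareGrid ∧
      IsSpecial (quotient (RAAG edgeGraph) squareGrid) ∧
      ¬ IsSpatial (quotient (RAAG edgeGraph) squareGrid)) := by
  refine ⟨fun Γ V Z _ h => h.isCospecial, ?_, diagonalAction, ?_⟩
  · rintro X ⟨W, _, _, Γ, V, Z, _, h, hX⟩
    exact ⟨RAAG Γ, _, V, Z, _, h.isCospecial, hX⟩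
  · let := diagonalAction
    have hτ : ∀ (g : RAAG edgeGraph) (p : ℤ × ℤ), g • p = p + (diagonalHom g).toAdd :=
      fun _ _ => rfl
    have hinj : ∀ g : RAAG edgeGraph, (diagonalHom g).toAdd = 0 → g = 1 := by
      intro g hg
      obtain ⟨m, n, rfl⟩ := exists_eq_zpow_mul_zpow g
      rw [diagonalHom_zpow, Prod.ext_iff] at hg
      simp only [Prod.fst_zero, Prod.snd_zero] at hg
      obtain rfl : m = 0 := by omega
      obtain rfl : n = 0 := by omega
      simp
    have hsurj : ∀ v : ℤ × ℤ, Even (v.1 + v.2) →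
        ∃ g : RAAG edgeGraph, (diagonalHom g).toAdd = v := by
      rintro ⟨x, y⟩ ⟨m, hm⟩
      simp only at hm
      -- The exponents solve `m - n = x` and `m + n = y`, where `x + y = m + m`.
      refine ⟨PresentedGroup.of 0 ^ m * PresentedGroup.of 1 ^ (y - m), ?_⟩
      rw [diagonalHom_zpow]
      ext
      · simp only
        omega
      · simp only
        omega
    have heven : ∀ g : RAAG edgeGraph,
        Even ((diagonalHom g).toAdd.1 + (diagonalHom g).toAdd.2) := by
      intro g
      obtain ⟨m, n, rfl⟩ := exists_eq_zpow_mul_zpow g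
      rw [diagonalHom_zpow]
      exact ⟨m, by simp only; ring⟩
    have hspecial := isCospecial_squareGrid hτ hinj
    have hspatial := not_isSpatial_squareGrid hτ hsurj heven
    refine ⟨fun p => ?_, fun p => ?_, ⟨hspecial.toIsFreeCAT0Action, cocompact_squareGrid hτ hsurj⟩,
      hspecial, fun h => hspatial ?_, ?_, hspatial⟩
    · rw [hτ, diagonalHom_of]
      rfl
    · rw [hτ, diagonalHom_of]
      rfl
    · exact ⟨Fin 2, inferInstance, inferInstance, edgeGraph, ℤ × ℤ, squareGrid, _, h,
        ⟨⟨fun _ => Equiv.refl _, fun _ _ => rfl⟩⟩⟩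
    · exact ⟨RAAG edgeGraph, _, ℤ × ℤ, squareGrid, _, hspecial,
        ⟨⟨fun _ => Equiv.refl _, fun _ _ => rfl⟩⟩⟩
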